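/- Let $G=(V,E)$ be a finite simple graph with $n$ vertices and $m$ edges, and let $S$ be a BFS-tree of $G$, that is, a rooted spanning tree of $G$ such that every edge of $G$ not in $S$ joins two vertices on the same level or on consecutive levels of $S$ (the level of a vertex is its distance from the root in $S$). A straight-line compatible drawing of $\langle G,S\rangle$ places the vertices at distinct points of the plane and draws the edges as straight-line segments, no edge passing through a vertex that is not its end-vertex, such that no edge of $S$ is crossed by an edge of $G$ (an edge of $S$ and another edge of $G$ meet at most in a common end-vertex). Then the following hold. 1. There is a straight-line compatible drawing $\Gamma$ of $\langle G,S\rangle$ in which the levels of $S$ lie on nested concentric circles: there are a centre $o$ and radii $r_0>r_1>r_2>\dots>0$ such that every vertex of level $l$ has distance $r_l$ from $o$. 2. Such a drawing can be computed in $O(n+m)$ time in the real RAM model, when the input consists of $n$, $m$, the root of $S$, and the list of edges of $G$ (in any order) in which the edges of $S$ are marked. The area of the drawings computed by the algorithm may be exponential: for all sufficiently large $n$ there is an instance with $n$ vertices whose computed drawing has area at least $c\cdot 2^n$, where $c>0$ is a constant. Here the area of a drawing is the area of a smallest enclosing rectangle after scaling so that any two vertices have distance at least $1$. 3. Consequently,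 for every finite connected graph $G$ and every vertex $r$ of $G$ there is a BFS-tree $S$ of $G$ with root $r$ and a straight-line compatible drawing of $\langle G,S\rangle$; in particular, every finite connected graph has a spanning tree that is not crossed in some straight-line drawing of the graph. -/

import Mathlib

universe u

/-! ### Straight-line drawings -/

/-- The Euclidean plane. -/
abbrev Plane : Type := EuclideanSpace ℝ (Fin 2)

/-- `S` is a BFS-tree of `G` with root `root`: a rooted spanning tree of `G` such that every edge of
`G` that is not in `S` joins vertices on the same level or on consecutive levels of `S`. The level
of a vertex is its distance from the root in `S`. (`S` spans, being a graph on all of `V`.) -/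
structure IsBFSTree {V : Type u} (G S : SimpleGraph V) (root : V) : Prop where
  le : S ≤ G
  isTree : S.IsTree
  levels : ∀ a b, G.Adj a b → ¬ S.Adj a b →
    S.dist root a = S.dist root b ∨
    S.dist root a = S.dist root b + 1 ∨
    S.dist root b = S.dist root a + 1

/-- Vertices are distinct points, edges are segments, and no edge passes through a vertex other
than its end-vertices. -/
structure IsStraightLineDrawing {V : Type u} (G : SimpleGraph V) (Γ : V → Plane) : Prop where
  injective : Function.Injective Γ
  not_mem_edge : ∀ a b w, G.Adj a b → w ≠ a → w ≠ b → Γ w ∉ segment ℝ (Γ a) (Γ b)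

/-- A straight-line compatible drawing of `⟨G, S⟩`: a straight-line drawing of `G` in which no edge
of `S` is crossed by another edge of `G`, that is, an edge of `S` and another edge of `G` meet at
most in a common end-vertex. -/
structure IsCompatibleDrawing {V : Type u} (G S : SimpleGraph V) (Γ : V → Plane) : Prop where
  drawing : IsStraightLineDrawing G Γ
  not_crossed : ∀ a b c d, S.Adj a b → G.Adj c d → s(a, b) ≠ s(c, d) →
    segment ℝ (Γ a) (Γ b) ∩ segment ℝ (Γ c) (Γ d) ⊆ Γ '' (({a, b} : Set V) ∩ {c, d})

/-- The levels of the tree `S` lie on concentric circles, each strictly inside the previous one. -/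
def LevelsOnNestedCircles {V : Type u} (S : SimpleGraph V) (root : V) (Γ : V → Plane) : Prop :=
  ∃ (o : Plane) (r : ℕ → ℝ), StrictAnti r ∧ (∀ l, 0 < r l) ∧
    ∀ v, dist (Γ v) o = r (S.dist root v)

/-- The area of a straight-line drawing: the drawing is scaled so that any two vertices
are at distance at least one, and the area of a smallest enclosing rectangle (in any orientation)
is taken. -/
noncomputable def drawingArea {V : Type u} (Γ : V → Plane) : ℝ :=
  sInf {A : ℝ | ∃ s θ a b c d : ℝ, 0 < s ∧
    (∀ v w, v ≠ w → 1 ≤ s * dist (Γ v) (Γ w)) ∧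
    (∀ v, s * (Real.cos θ * Γ v 0 + Real.sin θ * Γ v 1) ∈ Set.Icc a b ∧
          s * (-Real.sin θ * Γ v 0 + Real.cos θ * Γ v 1) ∈ Set.Icc c d) ∧
    A = (b - a) * (d - c)}

/-! ### The real RAM -/

/-- Instructions of a real RAM. There are two memories, `I` of natural numbers (used for counting
and for addresses) and `R` of real numbers, a read-only input array of natural numbers and a
write-only output array of real numbers. -/
inductive RealRAM.Instr : Type
  /-- `I[d] := k` -/
  | iconst (d k : ℕ)
  /-- `I[d] := I[a] + I[b]` -/
  | iadd (d a b : ℕ)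
  /-- `I[d] := I[a] - I[b]`, truncated at `0` -/
  | isub (d a b : ℕ)
  /-- `I[d] := I[I[a]]` -/
  | iload (d a : ℕ)
  /-- `I[I[a]] := I[b]` -/
  | istore (a b : ℕ)
  /-- `I[d] := input[I[a]]` -/
  | input (d a : ℕ)
  /-- `R[d] := z` -/
  | rconst (d : ℕ) (z : ℤ)
  /-- `R[d] := I[a]` -/
  | cast (d a : ℕ)
  /-- `R[d] := R[a] + R[b]` -/
  | radd (d a b : ℕ)
  /-- `R[d] := R[a] - R[b]` -/
  | rsub (d a b : ℕ)
  /-- `R[d] := R[a] * R[b]` -/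
  | rmul (d a b : ℕ)
  /-- `R[d] := R[a] / R[b]`; the machine gets stuck if `R[b] = 0` -/
  | rdiv (d a b : ℕ)
  /-- `R[d] := R[I[a]]` -/
  | rload (d a : ℕ)
  /-- `R[I[a]] := R[b]` -/
  | rstore (a b : ℕ)
  /-- `output[I[a]] := R[b]` -/
  | output (a b : ℕ)
  /-- jump to instruction `l` if `I[a] ≤ I[b]` -/
  | ijump (a b l : ℕ)
  /-- jump to instruction `l` if `R[a] ≤ R[b]` -/
  | rjump (a b l : ℕ)
  /-- stop -/
  | halt

/-- A program is a finite list of instructions. -/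
abbrev RealRAM.Program : Type := List RealRAM.Instr

/-- A configuration: program counter, the two memories and the output array. -/
structure RealRAM.Config : Type where
  pc : ℕ
  I : ℕ → ℕ
  R : ℕ → ℝ
  out : ℕ → ℝ

/-- The initial configuration: everything is zero. -/
def RealRAM.Config.init : RealRAM.Config := ⟨0, fun _ => 0, fun _ => 0, fun _ => 0⟩

open Classical in
/-- Execution of one instruction on the input array `x`; `none` if there is no next
configuration. -/
noncomputable def RealRAM.exec (x : ℕ → ℕ) (c : RealRAM.Config) :
    RealRAM.Instr → Option RealRAM.Config
  | .iconst d k => some { c with pc := c.pc + 1, I := Function.update c.I d k }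
  | .iadd d a b => some { c with pc := c.pc + 1, I := Function.update c.I d (c.I a + c.I b) }
  | .isub d a b => some { c with pc := c.pc + 1, I := Function.update c.I d (c.I a - c.I b) }
  | .iload d a => some { c with pc := c.pc + 1, I := Function.update c.I d (c.I (c.I a)) }
  | .istore a b => some { c with pc := c.pc + 1, I := Function.update c.I (c.I a) (c.I b) }
  | .input d a => some { c with pc := c.pc + 1, I := Function.update c.I d (x (c.I a)) }
  | .rconst d z => some { c with pc := c.pc + 1, R := Function.update c.R d (z : ℝ) }
  | .cast d a => some { c with pc := c.pc + 1, R := Function.update c.R d (c.I a : ℝ) }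
  | .radd d a b => some { c with pc := c.pc + 1, R := Function.update c.R d (c.R a + c.R b) }
  | .rsub d a b => some { c with pc := c.pc + 1, R := Function.update c.R d (c.R a - c.R b) }
  | .rmul d a b => some { c with pc := c.pc + 1, R := Function.update c.R d (c.R a * c.R b) }
  | .rdiv d a b => if c.R b = 0 then none else
      some { c with pc := c.pc + 1, R := Function.update c.R d (c.R a / c.R b) }
  | .rload d a => some { c with pc := c.pc + 1, R := Function.update c.R d (c.R (c.I a)) }
  | .rstore a b => some { c with pc := c.pc + 1, R := Function.update c.R (c.I a) (c.R b) }
  | .output a b => some { c with pc := c.pc + 1, out := Function.update c.out (c.I a) (c.R b) }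
  | .ijump a b l => some { c with pc := if c.I a ≤ c.I b then l else c.pc + 1 }
  | .rjump a b l => some { c with pc := if c.R a ≤ c.R b then l else c.pc + 1 }
  | .halt => none

/-- One step of the program `P` on the input array `x`. -/
noncomputable def RealRAM.step (P : RealRAM.Program) (x : ℕ → ℕ) (c : RealRAM.Config) :
    Option RealRAM.Config :=
  P[c.pc]?.bind (RealRAM.exec x c)

/-- The configuration after `t` steps of `P` on the input array `x`, if there is one. -/
noncomputable def RealRAM.run (P : RealRAM.Program) (x : ℕ → ℕ) : ℕ → Option RealRAM.Config
  | 0 => some RealRAM.Config.init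
  | t + 1 => (RealRAM.run P x t).bind (RealRAM.step P x)

/-- On the input array `x`, the program `P` executes `t` instructions, then reaches the instruction
`halt`, and the output array is then `y`. -/
def RealRAM.HaltsWith (P : RealRAM.Program) (x : ℕ → ℕ) (t : ℕ) (y : ℕ → ℝ) : Prop :=
  ∃ c, RealRAM.run P x t = some c ∧ P[c.pc]? = some .halt ∧ c.out = y

/-! ### Instances and drawings as arrays -/

/-- `ends` lists the edges of `G`, each exactly once, in any order and with the end-vertices in any
order, and `mark` tells which of them are edges of `S`. -/
structure IsEdgeList {n m : ℕ} (G S : SimpleGraph (Fin n))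
    (ends : Fin m → Fin n × Fin n) (mark : Fin m → Bool) : Prop where
  injective : Function.Injective fun j => s((ends j).1, (ends j).2)
  range_eq : (Set.range fun j => s((ends j).1, (ends j).2)) = G.edgeSet
  mark_iff : ∀ j, mark j = true ↔ S.Adj (ends j).1 (ends j).2

/-- The input array of an instance: the number `n` of vertices, the number `m` of edges, the root,
and then three cells for every edge, namely its end-vertices and its mark. -/
def encodeInstance {n m : ℕ} (ends : Fin m → Fin n × Fin n) (mark : Fin m → Bool)
    (root : Fin n) : ℕ → ℕ
  | 0 => n
  | 1 => m
  | 2 => root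
  | k + 3 =>
    if h : k / 3 < m then
      if k % 3 = 0 then (ends ⟨k / 3, h⟩).1
      else if k % 3 = 1 then (ends ⟨k / 3, h⟩).2
      else (mark ⟨k / 3, h⟩).toNat
    else 0

/-- The drawing in an output array: vertex `v` has coordinates `(y[2v], y[2v+1])`. -/
def decodeDrawing (n : ℕ) (y : ℕ → ℝ) (v : Fin n) : Plane :=
  !₂[y (2 * v), y (2 * v + 1)]

/-!
The circles have radii slightly above `1`, and level `l` has a scale `δ l` with
`δ (l + 1) = δ l ^ 2 / q`. Vertices of level `l` have distance at least `δ l`, while a child is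
placed within a distance of order `δ l ^ 2` from its parent, on a circle whose radius is smaller by
an amount of the same order. So the edges of the tree descend steeply. A chord between vertices of
the same or of consecutive levels has length at least `δ l / 2`, and outside the unit disc it is
close to one of its ends and almost tangential there; it cannot meet a steep and very short edge
elsewhere than in a common end.

For the linear running time, the parents are found without adjacency lists. Every vertex stores the
number of its neighbours in the tree and the sum of their addresses. At a leaf this sum is the
address of the only neighbour, which is the parent and from which the leaf is then subtracted. One
scan, which after the removal of a leaf turns to its parent as long as this has become a leaf,
removes all vertices other than the root, and the reverse order of removal visits parents before
their children.

For the area, three children of the root span a triangle whose size is a fixed power of `1 / q`,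
while the last edge of a path from one of them has length at most of order `δ l`, which is
exponentially small.
-/

section LevelledTrees

variable {V : Type u} {G S : SimpleGraph V} {root : V}

/-- `p` is a parent of `v` when `S` is levelled by the distance from `root`. In a tree every vertex
other than the root has exactly one parent. -/
def IsParent (S : SimpleGraph V) (root p v : V) : Prop :=
  S.Adj p v ∧ S.dist root v = S.dist root p + 1

theorem exists_isParent (hS : S.Connected) {v : V} (hv : v ≠ root) : ∃ p, IsParent S root p v := by
  obtain ⟨w, hw⟩ := hS.exists_walk_length_eq_dist v root
  cases w with
  | nil => exact absurd rfl hv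
  | @cons _ p _ hadj w' =>
    refine ⟨p, hadj.symm, ?_⟩
    have h1 : S.dist root p ≤ w'.length := S.dist_comm (u := root) ▸ S.dist_le w'
    have h2 := hS.dist_triangle (u := root) (v := p) (w := v)
    rw [SimpleGraph.dist_eq_one_iff_adj.2 hadj.symm] at h2
    rw [SimpleGraph.Walk.length_cons, S.dist_comm] at hw
    omega

theorem IsParent.ne_root {p v : V} (hp : IsParent S root p v) : v ≠ root := by
  rintro rfl
  simpa using hp.2

theorem isParent_or_isParent_of_adj (hS : S.IsTree) {a b : V} (h : S.Adj a b) :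
    IsParent S root a b ∨ IsParent S root b a :=
  (hS.dist_eq_dist_add_one_of_adj root h).symm.imp (⟨h, ·⟩) (⟨h.symm, ·⟩)

theorem dist_le_of_mem_support {a b v : V} {w : G.Walk a b} (hw : w.length = G.dist a b)
    (hv : v ∈ w.support) : G.dist a v ≤ G.dist a b := by
  classical
  exact (G.dist_le (w.takeUntil v hv)).trans (hw ▸ w.length_takeUntil_le_length hv)

theorem IsParent.eq (hS : S.IsTree) {p p' v : V} (hp : IsParent S root p v)
    (hp' : IsParent S root p' v) : p = p' := by
  obtain ⟨w, hw, -⟩ := hS.connected.exists_path_of_dist root v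
  have eq_penultimate {a : V} (ha : IsParent S root a v) : a = w.penultimate := by
    obtain ⟨r, hr, hrl⟩ := hS.connected.exists_path_of_dist root a
    refine hS.isAcyclic.eq_penultimate_of_adj_end hw ha.1.symm
      (hS.isAcyclic.mem_support_of_ne_mem_support_of_adj_of_isPath hw hr ha.1.symm fun hv => ?_)
    have := dist_le_of_mem_support hrl hv
    have := ha.2
    omega
  rw [eq_penultimate hp, eq_penultimate hp']

theorem exists_potential (hS : S.IsTree) (root : V) (F : V → ℝ) :
    ∃ t : V → ℝ, t root = 0 ∧ ∀ p v, IsParent S root p v → t v = t p + F v := by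
  choose path hpath hlen using hS.connected.exists_path_of_dist root
  have path_root : path root = .nil := (SimpleGraph.Walk.isPath_iff_nil.1 (hpath root)).eq_nil
  have path_eq {p v : V} (h : IsParent S root p v) : path v = (path p).concat h.1 := by
    have hv : v ∉ (path p).support := fun hv => by
      have := dist_le_of_mem_support (hlen p) hv
      have := h.2
      omega
    exact (hS.existsUnique_path root v).unique (hpath v) ((hpath p).concat hv h.1)
  refine ⟨fun v => ((path v).support.map F).sum - F root, ?_, fun p v h => ?_⟩
  · simp [path_root]
  · simp only [path_eq h, SimpleGraph.Walk.support_concat, List.map_append, List.sum_append,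
      List.map_cons, List.map_nil, List.sum_singleton]
    ring

end LevelledTrees

section ParentGraph

variable {V : Type u}

/-- The tree given by a root and a parent function: it joins every vertex other than the root to its
parent. -/
def parentGraph (root : V) (parent : V → V) : SimpleGraph V :=
  SimpleGraph.fromRel fun v p => v ≠ root ∧ p = parent v

variable {root : V} {parent : V → V} {level : V → ℕ}

theorem parentGraph_adj (hlevel : ∀ v, v ≠ root → level (parent v) + 1 = level v) {a b : V} :
    (parentGraph root parent).Adj a b ↔
      (a ≠ root ∧ b = parent a) ∨ (b ≠ root ∧ a = parent b) := by
  rw [parentGraph, SimpleGraph.fromRel_adj, and_iff_right_iff_imp]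
  rintro (⟨ha, hab⟩ | ⟨ha, hab⟩) rfl <;>
    exact absurd (hlevel a ha) (by rw [← hab]; omega)

theorem exists_walk_parentGraph (hlevel : ∀ v, v ≠ root → level (parent v) + 1 = level v) (v : V) :
    ∃ w : (parentGraph root parent).Walk v root, w.length ≤ level v := by
  induction hl : level v using Nat.strong_induction_on generalizing v with | _ l ih
  by_cases hv : v = root
  · exact hv ▸ ⟨.nil, Nat.zero_le l⟩
  · have := hlevel v hv
    obtain ⟨w, hw⟩ := ih _ (by omega) (parent v) rfl
    refine ⟨.cons ((parentGraph_adj hlevel).2 (.inl ⟨hv, rfl⟩)) w, ?_⟩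
    rw [SimpleGraph.Walk.length_cons]
    omega

theorem parentGraph_connected (hlevel : ∀ v, v ≠ root → level (parent v) + 1 = level v) :
    (parentGraph root parent).Connected :=
  (SimpleGraph.connected_iff_exists_forall_reachable _).2
    ⟨root, fun v => (exists_walk_parentGraph hlevel v).choose.reachable.symm⟩

theorem level_le_add_length (hlevel : ∀ v, v ≠ root → level (parent v) + 1 = level v) {a b : V}
    (w : (parentGraph root parent).Walk a b) : level a ≤ level b + w.length := by
  induction w with
  | nil => simp
  | cons h w ih =>
    rw [SimpleGraph.Walk.length_cons]
    rcases (parentGraph_adj hlevel).1 h with ⟨hv, rfl⟩ | ⟨hv, rfl⟩ <;>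
      have := hlevel _ hv <;> omega

theorem parentGraph_dist (hlevel : ∀ v, v ≠ root → level (parent v) + 1 = level v)
    (hroot : level root = 0) (v : V) : (parentGraph root parent).dist root v = level v := by
  rw [SimpleGraph.dist_comm]
  obtain ⟨w, hw⟩ := exists_walk_parentGraph hlevel v
  obtain ⟨r, hr⟩ := (parentGraph_connected hlevel).exists_walk_length_eq_dist v root
  have := level_le_add_length hlevel r
  exact le_antisymm ((SimpleGraph.dist_le w).trans hw) (by omega)

theorem eq_parent_of_level_le (hlevel : ∀ v, v ≠ root → level (parent v) + 1 = level v) {a b : V}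
    (h : (parentGraph root parent).Adj a b) (hab : level b ≤ level a) : b = parent a := by
  rcases (parentGraph_adj hlevel).1 h with ⟨-, h⟩ | ⟨hb, rfl⟩
  · exact h
  · have := hlevel b hb
    omega

theorem parentGraph_isTree (hlevel : ∀ v, v ≠ root → level (parent v) + 1 = level v) :
    (parentGraph root parent).IsTree := by
  classical
  refine ⟨parentGraph_connected hlevel, fun v c hc => ?_⟩
  -- Both neighbours on the cycle of a vertex of maximal level would be its parent.
  obtain ⟨a, ha, hmax⟩ := c.support.toFinset.exists_max_image level ⟨v, by simp⟩
  rw [List.mem_toFinset] at ha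
  have hc' := hc.rotate ha
  have le_level {b : V} (hb : b ∈ (c.rotate a ha).support) : level b ≤ level a :=
    hmax b (by simpa using hb)
  refine hc'.snd_ne_penultimate (Eq.trans (b := parent a) ?_ (Eq.symm ?_))
  · exact eq_parent_of_level_le hlevel ((c.rotate a ha).adj_snd hc'.not_nil)
      (le_level (SimpleGraph.Walk.getVert_mem_support _ _))
  · exact eq_parent_of_level_le hlevel ((c.rotate a ha).adj_penultimate hc'.not_nil).symm
      (le_level (SimpleGraph.Walk.getVert_mem_support _ _))

theorem exists_isBFSTree {G : SimpleGraph V} (hG : G.Connected) (root : V) :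
    ∃ S : SimpleGraph V, IsBFSTree G S root := by
  choose! parent hparent using fun v (hv : v ≠ root) => exists_isParent hG hv
  have hlevel v (hv : v ≠ root) := (hparent v hv).2.symm
  have hdist := parentGraph_dist hlevel SimpleGraph.dist_self
  refine ⟨parentGraph root parent, fun a b hab => ?_, parentGraph_isTree hlevel,
    fun a b hab _ => ?_⟩
  · rcases (parentGraph_adj hlevel).1 hab with ⟨ha, rfl⟩ | ⟨hb, rfl⟩
    exacts [(hparent a ha).1.symm, (hparent b hb).1]
  · rw [hdist, hdist]
    rcases hab.diff_dist_adj (u := root) with h | h | h <;> omega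

theorem isBFSTree_self {S : SimpleGraph V} (hS : S.IsTree) (root : V) : IsBFSTree S S root where
  le := le_rfl
  isTree := hS
  levels _ _ h h' := absurd h h'

end ParentGraph

section SegmentGeometry

section NormedSpace

variable {E : Type*} [NormedAddCommGroup E] [NormedSpace ℝ E]

theorem norm_lineMap_sub_left (a b : E) {s : ℝ} (hs : 0 ≤ s) :
    ‖AffineMap.lineMap a b s - a‖ = s * ‖b - a‖ := by
  rw [← dist_eq_norm, dist_lineMap_left, Real.norm_of_nonneg hs, dist_comm, dist_eq_norm]

theorem norm_sub_left_le_of_mem_segment {a b x : E} (hx : x ∈ segment ℝ a b) :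
    ‖x - a‖ ≤ ‖b - a‖ := by
  rw [segment_eq_image_lineMap] at hx
  obtain ⟨s, ⟨hs₀, hs₁⟩, rfl⟩ := hx
  rw [norm_lineMap_sub_left a b hs₀]
  exact mul_le_of_le_one_left (norm_nonneg _) hs₁

theorem eq_or_eq_of_mem_segment_of_le_norm [StrictConvexSpace ℝ E] {a b x : E} {r : ℝ}
    (ha : ‖a‖ ≤ r) (hb : ‖b‖ ≤ r) (hx : x ∈ segment ℝ a b) (hr : r ≤ ‖x‖) : x = a ∨ x = b := by
  by_contra! hne
  rw [← insert_endpoints_openSegment] at hx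
  have hab : a ≠ b := fun h => hne.1 (by simpa [h] using hx)
  have hball := openSegment_subset_ball_of_ne (mem_closedBall_zero_iff.2 ha)
    (mem_closedBall_zero_iff.2 hb) hab ((hx.resolve_left hne.1).resolve_left hne.2)
  exact hr.not_gt (mem_ball_zero_iff.1 hball)

end NormedSpace

variable {E : Type*} [NormedAddCommGroup E] [InnerProductSpace ℝ E]

theorem norm_sq_lineMap (a b : E) (s : ℝ) :
    ‖AffineMap.lineMap a b s‖ ^ 2 =
      (1 - s) * ‖a‖ ^ 2 + s * ‖b‖ ^ 2 - s * (1 - s) * ‖b - a‖ ^ 2 := by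
  rw [AffineMap.lineMap_apply_module, norm_add_sq_real, norm_sub_sq_real, norm_smul, norm_smul,
    real_inner_smul_left, real_inner_smul_right, mul_pow, mul_pow, Real.norm_eq_abs,
    Real.norm_eq_abs, sq_abs, sq_abs, real_inner_comm]
  ring

theorem eq_right_of_mem_segment_of_norm_le {u w x : E} (h : ‖w - u‖ ^ 2 < ‖u‖ ^ 2 - ‖w‖ ^ 2)
    (hx : x ∈ segment ℝ u w) (hxw : ‖x‖ ≤ ‖w‖) : x = w := by
  rw [segment_symm, segment_eq_image_lineMap] at hx
  obtain ⟨s, ⟨hs₀, -⟩, rfl⟩ := hx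
  have hsq := pow_le_pow_left₀ (norm_nonneg _) hxw 2
  rw [norm_sq_lineMap, norm_sub_rev u w] at hsq
  have hs : s = 0 := by
    by_contra hs
    have hs_pos := lt_of_le_of_ne hs₀ (Ne.symm hs)
    nlinarith [sq_nonneg ‖w - u‖, mul_pos hs_pos (sub_pos.2 h), mul_nonneg hs₀ hs₀]
  simp [hs]

theorem eq_left_of_mem_segment_of_flat {u w x : E} {c : ℝ}
    (h : c * ‖w - u‖ < ‖u‖ ^ 2 - ‖w‖ ^ 2) (hx : x ∈ segment ℝ u w)
    (hflat : ‖u‖ ^ 2 - c * ‖x - u‖ ≤ ‖x‖ ^ 2) : x = u := by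
  rw [segment_eq_image_lineMap] at hx
  obtain ⟨s, ⟨hs₀, hs₁⟩, rfl⟩ := hx
  rw [norm_lineMap_sub_left u w hs₀, norm_sq_lineMap] at hflat
  have hchord : 0 ≤ s * (1 - s) * ‖w - u‖ ^ 2 :=
    mul_nonneg (mul_nonneg hs₀ (sub_nonneg.2 hs₁)) (sq_nonneg _)
  have hs : s = 0 := by
    by_contra hs
    have := mul_pos (lt_of_le_of_ne hs₀ (Ne.symm hs)) (sub_pos.2 h)
    linarith
  simp [hs]

theorem eq_of_mem_segment_of_mem_segment {u w w' x : E} (h : ‖w - u‖ ^ 2 < ‖u‖ ^ 2 - ‖w‖ ^ 2)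
    (h' : ‖w' - u‖ ^ 2 < ‖u‖ ^ 2 - ‖w'‖ ^ 2) (hww' : ‖w‖ = ‖w'‖) (hx : x ∈ segment ℝ u w)
    (hx' : x ∈ segment ℝ u w') (hxu : x ≠ u) : w = w' := by
  have hray : SameRay ℝ (w -ᵥ u) (w' -ᵥ u) :=
    (mem_segment_iff_wbtw.1 hx).sameRay_vsub_left.symm.trans
      (mem_segment_iff_wbtw.1 hx').sameRay_vsub_left
      fun h0 => absurd (vsub_eq_zero_iff_eq.1 h0) hxu
  rcases wbtw_total_of_sameRay_vsub_left hray with hw | hw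
  · exact eq_right_of_mem_segment_of_norm_le h' (mem_segment_iff_wbtw.2 hw) hww'.le
  · exact (eq_right_of_mem_segment_of_norm_le h (mem_segment_iff_wbtw.2 hw) hww'.ge).symm

/-- `x` is placed relative to `a` like a point of a chord from `a` near `a` and outside the unit
ball: it lies within `d / 8` of `a`, the squared norm drops between `a` and `x` at a rate of at most
`1 / 4`, and `x` lies strictly inside the ball through `a` unless it is `a`. -/
structure NearEnd (d : ℝ) (a x : E) : Prop where
  dist_le : ‖x - a‖ ≤ d / 8
  flat : ‖a‖ ^ 2 - 1 / 4 * ‖x - a‖ ≤ ‖x‖ ^ 2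
  eq_of_norm_le : ‖a‖ ≤ ‖x‖ → x = a

theorem nearEnd_lineMap {a b : E} {s d : ℝ} (hs₀ : 0 ≤ s) (hs : s ≤ 1 / 2) (ha : 1 ≤ ‖a‖)
    (hab : ‖b - a‖ < 1 / 8) (hd : 0 < d) (hdb : d ≤ 2 * ‖b - a‖)
    (had : 64 * (‖a‖ ^ 2 - 1) ≤ d ^ 2) (hbd : 16 * (‖b‖ ^ 2 - 1) ≤ ‖b - a‖ ^ 2) (hb : 1 ≤ ‖b‖)
    (hx : 1 ≤ ‖AffineMap.lineMap a b s‖) : NearEnd d a (AffineMap.lineMap a b s) := by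
  have hsub := norm_lineMap_sub_left a b hs₀
  have hsq := norm_sq_lineMap a b s
  set x : E := AffineMap.lineMap a b s with hx_def
  set L := ‖b - a‖
  have hL : 0 < L := by linarith
  have ha_sq : 0 ≤ ‖a‖ ^ 2 - 1 := sub_nonneg.2 (one_le_pow₀ ha)
  have hb_sq : 0 ≤ ‖b‖ ^ 2 - 1 := sub_nonneg.2 (one_le_pow₀ hb)
  have hx_sq : 1 ≤ ‖x‖ ^ 2 := one_le_pow₀ hx
  have hsL : 0 ≤ s * L ^ 2 := by positivity
  have had_L : ‖a‖ ^ 2 - 1 ≤ L ^ 2 / 16 := by nlinarith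
  have hchord : s * L ^ 2 / 2 ≤ s * (1 - s) * L ^ 2 := by nlinarith
  have hb_term : s * (‖b‖ ^ 2 - 1) ≤ s * L ^ 2 / 16 := by nlinarith
  refine ⟨?_, ?_, fun hle => ?_⟩
  · have h4 : s * L * L ≤ 4 * (‖a‖ ^ 2 - 1) := by nlinarith [mul_nonneg hs₀ ha_sq]
    rw [hsub]
    by_contra! hc
    nlinarith [mul_lt_mul_of_pos_right hc hL]
  · rw [hsub, hsq]
    have ha_term : s * (‖a‖ ^ 2 - 1) ≤ s * (L ^ 2 / 16) := by gcongr
    have hLL : s * L * L ≤ s * L * (1 / 8) := by gcongr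
    nlinarith [mul_nonneg hs₀ hsL, mul_nonneg hs₀ hb_sq]
  · have hle_sq := pow_le_pow_left₀ (norm_nonneg _) hle 2
    have h0 : s * L ^ 2 = 0 := by nlinarith [mul_nonneg hs₀ ha_sq]
    have hs0 : s = 0 := (mul_eq_zero.1 h0).resolve_right (by positivity)
    simp [hx_def, hs0]

theorem nearEnd_of_mem_segment {a b x : E} {d e : ℝ} (ha : 1 ≤ ‖a‖) (hb : 1 ≤ ‖b‖)
    (hab : ‖b - a‖ < 1 / 8) (hd : 0 < d) (he : 0 < e) (hdb : d ≤ 2 * ‖b - a‖)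
    (heb : e ≤ 2 * ‖b - a‖) (had : 64 * (‖a‖ ^ 2 - 1) ≤ d ^ 2) (hbe : 64 * (‖b‖ ^ 2 - 1) ≤ e ^ 2)
    (hx : x ∈ segment ℝ a b) (hx₁ : 1 ≤ ‖x‖) : NearEnd d a x ∨ NearEnd e b x := by
  rw [segment_eq_image_lineMap] at hx
  obtain ⟨s, ⟨hs₀, hs₁⟩, rfl⟩ := hx
  rcases le_total s (1 / 2) with hs | hs
  · exact .inl (nearEnd_lineMap hs₀ hs ha hab hd hdb had (by nlinarith) hb hx₁)
  · rw [← AffineMap.lineMap_apply_one_sub] at hx₁ ⊢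
    rw [norm_sub_rev] at hab hdb heb
    exact .inr (nearEnd_lineMap (by linarith) (by linarith) hb hab he heb hbe (by nlinarith) ha hx₁)

end SegmentGeometry

section FinePlacement

variable {E V : Type*} [NormedAddCommGroup E]

/-- `δ` is a scale of distances for the levels of a tree, decreasing at least by the factor `8` from
each level to the next. -/
structure IsLevelScale (δ : ℕ → ℝ) : Prop where
  pos : ∀ l, 0 < δ l
  zero_le_one : δ 0 ≤ 1
  succ_le : ∀ l, 8 * δ (l + 1) ≤ δ l

namespace IsLevelScale

variable {δ : ℕ → ℝ}

theorem strictAnti (h : IsLevelScale δ) : StrictAnti δ :=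
  strictAnti_nat_of_succ_lt fun l => by linarith [h.succ_le l, h.pos (l + 1)]

theorem le_one (h : IsLevelScale δ) (l : ℕ) : δ l ≤ 1 :=
  (h.strictAnti.antitone (Nat.zero_le l)).trans h.zero_le_one

theorem succ_sq_le (h : IsLevelScale δ) (l : ℕ) : 64 * δ (l + 1) ^ 2 ≤ δ l ^ 2 := by
  nlinarith [h.succ_le l, h.pos (l + 1)]

end IsLevelScale

/-- The radius of the circle of a level, as a function of the scale of that level. -/
noncomputable def levelRadius (x : ℝ) : ℝ := 1 + x ^ 2 / 256

theorem one_lt_levelRadius {x : ℝ} (hx : 0 < x) : 1 < levelRadius x := by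
  have : 0 < x ^ 2 / 256 := by positivity
  rw [levelRadius]
  linarith

theorem levelRadius_lt_levelRadius {x y : ℝ} (hx : 0 ≤ x) (hxy : x < y) :
    levelRadius x < levelRadius y := by
  rw [levelRadius, levelRadius]
  gcongr

theorem levelRadius_sq_sub_one_le {x : ℝ} (hx : 0 ≤ x) (hx₁ : x ≤ 1) :
    64 * (levelRadius x ^ 2 - 1) ≤ x ^ 2 := by
  rw [levelRadius]
  nlinarith [mul_nonneg (sq_nonneg x) (sub_nonneg.2 (pow_le_one₀ hx hx₁ : x ^ 2 ≤ 1))]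

theorem lt_levelRadius_sq_sub {x y : ℝ} (hx : 0 < x) (hxy : 8 * x ≤ y) (hy : y ≤ 1) :
    y ^ 2 / 200 < levelRadius y ^ 2 - levelRadius x ^ 2 := by
  have hx_sq : 64 * x ^ 2 ≤ y ^ 2 := by nlinarith
  have hx_le : x ^ 2 ≤ 1 := pow_le_one₀ hx.le (by linarith)
  have hx_four : x ^ 2 * x ^ 2 ≤ x ^ 2 := mul_le_of_le_one_left (sq_nonneg x) hx_le
  have hx_pos : 0 < x ^ 2 := by positivity
  rw [levelRadius, levelRadius]
  nlinarith [sq_nonneg (y ^ 2)]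

/-- A placement of the vertices of the levelled tree `S` on nested spheres of radii slightly above
`1` that is fine enough to be compatible: relative to the scale `δ l` of level `l`, vertices of that
level are far apart and the tree edges to the next level are short. -/
structure IsFinePlacement (S : SimpleGraph V) (root : V) (δ : ℕ → ℝ) (Γ : V → E) : Prop where
  scale : IsLevelScale δ
  norm_eq : ∀ v, ‖Γ v‖ = levelRadius (δ (S.dist root v))
  diam : ∀ a b, ‖Γ b - Γ a‖ < 1 / 8
  sep : ∀ a b, a ≠ b → S.dist root a = S.dist root b → δ (S.dist root a) ≤ ‖Γ b - Γ a‖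
  edge : ∀ p v, IsParent S root p v → ‖Γ v - Γ p‖ ≤ δ (S.dist root p) ^ 2 / 128

namespace IsFinePlacement

variable {G S : SimpleGraph V} {root : V} {δ : ℕ → ℝ} {Γ : V → E}

theorem one_lt_norm (h : IsFinePlacement S root δ Γ) (v : V) : 1 < ‖Γ v‖ :=
  h.norm_eq v ▸ one_lt_levelRadius (h.scale.pos _)

theorem norm_lt_norm (h : IsFinePlacement S root δ Γ) {a b : V}
    (hab : S.dist root b < S.dist root a) : ‖Γ a‖ < ‖Γ b‖ := by
  rw [h.norm_eq, h.norm_eq]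
  exact levelRadius_lt_levelRadius (h.scale.pos _).le (h.scale.strictAnti hab)

theorem norm_le_norm (h : IsFinePlacement S root δ Γ) {a b : V}
    (hab : S.dist root b ≤ S.dist root a) : ‖Γ a‖ ≤ ‖Γ b‖ := by
  rcases hab.lt_or_eq with hab | hab
  · exact (h.norm_lt_norm hab).le
  · rw [h.norm_eq, h.norm_eq, hab]

theorem norm_sq_sub_one_le (h : IsFinePlacement S root δ Γ) (v : V) :
    64 * (‖Γ v‖ ^ 2 - 1) ≤ δ (S.dist root v) ^ 2 := by
  rw [h.norm_eq]
  exact levelRadius_sq_sub_one_le (h.scale.pos _).le (h.scale.le_one _)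

theorem injective (h : IsFinePlacement S root δ Γ) : Function.Injective Γ := by
  intro a b hab
  by_contra hne
  rcases lt_trichotomy (S.dist root a) (S.dist root b) with hd | hd | hd
  · exact (h.norm_lt_norm hd).ne' (hab ▸ rfl)
  · have := h.sep a b hne hd
    rw [hab, sub_self, norm_zero] at this
    exact this.not_gt (h.scale.pos _)
  · exact (h.norm_lt_norm hd).ne (hab ▸ rfl)

theorem norm_edge_le (h : IsFinePlacement S root δ Γ) {p v : V} (hv : IsParent S root p v) :
    ‖Γ v - Γ p‖ ≤ δ (S.dist root p) / 128 := by
  refine (h.edge p v hv).trans ?_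
  gcongr
  exact pow_le_of_le_one (h.scale.pos _).le (h.scale.le_one _) two_ne_zero

theorem lt_norm_sq_sub (h : IsFinePlacement S root δ Γ) {a b : V}
    (hab : S.dist root a < S.dist root b) :
    δ (S.dist root a) ^ 2 / 200 < ‖Γ a‖ ^ 2 - ‖Γ b‖ ^ 2 := by
  rw [h.norm_eq, h.norm_eq]
  refine lt_levelRadius_sq_sub (h.scale.pos _) (le_trans ?_ (h.scale.succ_le _)) (h.scale.le_one _)
  have := h.scale.strictAnti.antitone (Nat.succ_le_of_lt hab)
  gcongr

theorem slope_edge (h : IsFinePlacement S root δ Γ) {p v : V} (hv : IsParent S root p v) :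
    1 / 4 * ‖Γ v - Γ p‖ < ‖Γ p‖ ^ 2 - ‖Γ v‖ ^ 2 := by
  have hgap := h.lt_norm_sq_sub (a := p) (b := v) (by rw [hv.2]; omega)
  linarith [h.edge p v hv, sq_nonneg (δ (S.dist root p))]

theorem sq_edge_lt (h : IsFinePlacement S root δ Γ) {p v : V} (hv : IsParent S root p v) :
    ‖Γ v - Γ p‖ ^ 2 < ‖Γ p‖ ^ 2 - ‖Γ v‖ ^ 2 := by
  nlinarith [h.slope_edge hv, h.diam p v, norm_nonneg (Γ v - Γ p)]

theorem exists_ancestor (h : IsFinePlacement S root δ Γ) (hS : S.Connected) (j k : ℕ) (v : V)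
    (hv : S.dist root v = j + k) : ∃ a, S.dist root a = j ∧
      ‖Γ v - Γ a‖ ≤ (δ j ^ 2 - δ (j + k) ^ 2) / 64 ∧ (k = 0 → a = v) := by
  induction k generalizing v with
  | zero => exact ⟨v, hv, by simp, fun _ => rfl⟩
  | succ k ih =>
    have hne : v ≠ root := by
      rintro rfl
      rw [SimpleGraph.dist_self] at hv
      omega
    obtain ⟨p, hp⟩ := exists_isParent hS hne
    have hpk : S.dist root p = j + k := by have := hp.2; omega
    obtain ⟨a, ha, hpa, -⟩ := ih p hpk
    refine ⟨a, ha, ?_, by simp⟩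
    have hvp := h.edge p v hp
    rw [hpk] at hvp
    have hscale := h.scale.succ_sq_le (j + k)
    rw [← add_assoc]
    linarith [norm_sub_le_norm_sub_add_norm_sub (Γ v) (Γ p) (Γ a), sq_nonneg (δ (j + k))]

theorem eq_of_nearEnd_of_ancestor (h : IsFinePlacement S root δ Γ) {a a' : V} {x : E}
    (ha : S.dist root a' = S.dist root a) (hn : NearEnd (δ (S.dist root a)) (Γ a) x)
    (hx : ‖x - Γ a'‖ ≤ δ (S.dist root a) ^ 2 / 64) : a' = a := by
  by_contra hne
  have hsep := h.sep a' a hne ha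
  have hxa := hn.dist_le
  rw [ha] at hsep
  rw [norm_sub_rev] at hxa
  have hpos := h.scale.pos (S.dist root a)
  have hsq : δ (S.dist root a) ^ 2 ≤ δ (S.dist root a) :=
    pow_le_of_le_one hpos.le (h.scale.le_one _) two_ne_zero
  linarith [norm_sub_le_norm_sub_add_norm_sub (Γ a) x (Γ a')]

theorem sep_le_two_mul_norm_sub (h : IsFinePlacement S root δ Γ) (hS : S.Connected) {a b : V}
    (hab : ¬ S.Adj a b) (hne : a ≠ b)
    (hlev : S.dist root a = S.dist root b ∨ S.dist root b = S.dist root a + 1) :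
    δ (S.dist root a) ≤ 2 * ‖Γ b - Γ a‖ := by
  have hpos := h.scale.pos (S.dist root a)
  rcases hlev with heq | hsucc
  · linarith [h.sep a b hne heq]
  · obtain ⟨p, hp⟩ := exists_isParent hS (v := b) (root := root) fun hb => by
      rw [hb, SimpleGraph.dist_self] at hsucc
      omega
    have hdist : S.dist root a = S.dist root p := by have := hp.2; omega
    have hsep := h.sep a p (fun hap => hab (hap ▸ hp.1)) hdist
    have hedge := h.norm_edge_le hp
    rw [norm_sub_rev, ← hdist] at hedge
    linarith [norm_sub_le_norm_sub_add_norm_sub (Γ p) (Γ b) (Γ a)]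

variable [InnerProductSpace ℝ E]

theorem eq_child_of_mem_edge (h : IsFinePlacement S root δ Γ) {p v : V} {x : E}
    (hv : IsParent S root p v) (hx : x ∈ segment ℝ (Γ p) (Γ v)) (hxv : ‖x‖ ≤ ‖Γ v‖) : x = Γ v :=
  eq_right_of_mem_segment_of_norm_le (h.sq_edge_lt hv) hx hxv

theorem norm_child_le_of_mem_edge (h : IsFinePlacement S root δ Γ) {p v : V} {x : E}
    (hv : IsParent S root p v) (hx : x ∈ segment ℝ (Γ p) (Γ v)) : ‖Γ v‖ ≤ ‖x‖ := by
  by_contra! hxv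
  exact hxv.ne (congrArg norm (h.eq_child_of_mem_edge hv hx hxv.le))

theorem norm_le_norm_parent_of_mem_edge (h : IsFinePlacement S root δ Γ) {p v : V} {x : E}
    (hv : IsParent S root p v) (hx : x ∈ segment ℝ (Γ p) (Γ v)) : ‖x‖ ≤ ‖Γ p‖ :=
  mem_closedBall_zero_iff.1 ((convex_closedBall (0 : E) _).segment_subset
    (mem_closedBall_zero_iff.2 le_rfl)
    (mem_closedBall_zero_iff.2 (h.norm_le_norm (by rw [hv.2]; omega))) hx)

theorem eq_or_eq_of_mem_edges (h : IsFinePlacement S root δ Γ) {u w a b : V} {x : E}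
    (hw : IsParent S root u w) (hb : IsParent S root a b)
    (hle : S.dist root a ≤ S.dist root u) (hne : ¬ (u = a ∧ w = b))
    (hx : x ∈ segment ℝ (Γ u) (Γ w)) (hx' : x ∈ segment ℝ (Γ a) (Γ b)) :
    x = Γ u ∧ (u = a ∨ u = b) := by
  rcases hle.lt_or_eq with hlt | heq
  · have hub : ‖Γ u‖ ≤ ‖Γ b‖ := h.norm_le_norm (by rw [hb.2]; omega)
    have hxb := h.eq_child_of_mem_edge hb hx' ((h.norm_le_norm_parent_of_mem_edge hw hx).trans hub)
    have hwu : ‖Γ w‖ ≤ ‖Γ u‖ := h.norm_le_norm (by rw [hw.2]; omega)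
    rcases eq_or_eq_of_mem_segment_of_le_norm le_rfl hwu hx (hxb ▸ hub) with hxu | hxw
    · exact ⟨hxu, .inr (h.injective (hxu.symm.trans hxb))⟩
    · have hwb := h.injective (hxw.symm.trans hxb)
      have h1 := hw.2
      have h2 := hb.2
      rw [hwb] at h1
      omega
  · have hua : u = a := by
      by_contra hua
      have hsep := h.sep u a hua heq.symm
      have hxu := (norm_sub_left_le_of_mem_segment hx).trans (h.norm_edge_le hw)
      have hxa := (norm_sub_left_le_of_mem_segment hx').trans (h.norm_edge_le hb)
      rw [norm_sub_rev] at hxa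
      rw [heq] at hxa
      linarith [norm_sub_le_norm_sub_add_norm_sub (Γ a) x (Γ u), h.scale.pos (S.dist root u)]
    subst hua
    have hwb : ‖Γ w‖ = ‖Γ b‖ := by rw [h.norm_eq, h.norm_eq, hw.2, hb.2]
    refine ⟨by_contra fun hxu => hne ⟨rfl, h.injective ?_⟩, .inl rfl⟩
    exact eq_of_mem_segment_of_mem_segment (h.sq_edge_lt hw) (h.sq_edge_lt hb) hwb hx hx' hxu

theorem eq_of_nearEnd_of_mem_edge (h : IsFinePlacement S root δ Γ) (hS : S.Connected)
    {u w a : V} {x : E} (hw : IsParent S root u w) (hle : S.dist root a ≤ S.dist root u)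
    (hx : x ∈ segment ℝ (Γ u) (Γ w)) (hn : NearEnd (δ (S.dist root a)) (Γ a) x) :
    x = Γ u ∧ a = u := by
  obtain ⟨k, hk⟩ := Nat.exists_eq_add_of_le hle
  obtain ⟨a', ha', hua', hk0⟩ := h.exists_ancestor hS _ k u hk
  have hxu := (norm_sub_left_le_of_mem_segment hx).trans (h.edge u w hw)
  rw [hk] at hxu
  have hxa' : ‖x - Γ a'‖ ≤ δ (S.dist root a) ^ 2 / 64 := by
    linarith [norm_sub_le_norm_sub_add_norm_sub x (Γ u) (Γ a'),
      sq_nonneg (δ (S.dist root a + k))]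
  obtain rfl := (h.eq_of_nearEnd_of_ancestor ha' hn hxa').symm
  rcases Nat.eq_zero_or_pos k with rfl | hk_pos
  · obtain rfl := hk0 rfl
    exact ⟨eq_left_of_mem_segment_of_flat (h.slope_edge hw) hx hn.flat, rfl⟩
  · -- `x` is at least as deep as `u`, which is too deep for a flat path from `a`.
    exfalso
    have hxu := pow_le_pow_left₀ (norm_nonneg x) (h.norm_le_norm_parent_of_mem_edge hw hx) 2
    have hgap := h.lt_norm_sq_sub (a := a) (b := u) (by omega)
    have hflat := hn.flat
    linarith [sq_nonneg (δ (S.dist root a))]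

theorem eq_end_of_nearEnd (h : IsFinePlacement S root δ Γ) (hS : S.Connected) {u w a : V} {x : E}
    (hw : IsParent S root u w) (hle : S.dist root a ≤ S.dist root u + 1)
    (hx : x ∈ segment ℝ (Γ u) (Γ w)) (hn : NearEnd (δ (S.dist root a)) (Γ a) x) :
    x = Γ a ∧ (a = u ∨ a = w) := by
  rcases hle.lt_or_eq with hlt | heq
  · obtain ⟨hxu, rfl⟩ := h.eq_of_nearEnd_of_mem_edge hS hw (Nat.le_of_lt_succ hlt) hx hn
    exact ⟨hxu, .inl rfl⟩
  · have haw : ‖Γ a‖ = ‖Γ w‖ := by rw [h.norm_eq, h.norm_eq, heq, hw.2]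
    have hxa := hn.eq_of_norm_le (haw ▸ h.norm_child_le_of_mem_edge hw hx)
    have hxw := h.eq_child_of_mem_edge hw hx (hxa ▸ haw.le)
    exact ⟨hxa, .inr (h.injective (hxa.symm.trans hxw))⟩

theorem exists_common_end_of_not_adj (h : IsFinePlacement S root δ Γ) (hS : S.Connected)
    {u w a b : V} {x : E} (hw : IsParent S root u w) (hab : ¬ S.Adj a b) (hne : a ≠ b)
    (hlev : S.dist root a = S.dist root b ∨ S.dist root b = S.dist root a + 1)
    (hx : x ∈ segment ℝ (Γ u) (Γ w)) (hx' : x ∈ segment ℝ (Γ a) (Γ b)) :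
    ∃ v, x = Γ v ∧ (v = u ∨ v = w) ∧ (v = a ∨ v = b) := by
  have hwx := h.norm_child_le_of_mem_edge hw hx
  rcases le_or_gt (S.dist root w) (S.dist root a) with hdeep | hdeep
  · have hxend := eq_or_eq_of_mem_segment_of_le_norm (h.norm_le_norm hdeep)
      (h.norm_le_norm (by omega)) hx' hwx
    rcases hxend with rfl | rfl
    · have hxw := h.eq_child_of_mem_edge hw hx (h.norm_le_norm hdeep)
      exact ⟨a, rfl, .inr (h.injective hxw), .inl rfl⟩
    · have hxw := h.eq_child_of_mem_edge hw hx (h.norm_le_norm (by omega))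
      exact ⟨b, rfl, .inr (h.injective hxw), .inr rfl⟩
  · have hw_dist := hw.2
    have hda := h.sep_le_two_mul_norm_sub hS hab hne hlev
    have hdb := (h.scale.strictAnti.antitone
      (show S.dist root a ≤ S.dist root b by omega)).trans hda
    have hnear := nearEnd_of_mem_segment (h.one_lt_norm a).le (h.one_lt_norm b).le (h.diam a b)
      (h.scale.pos _) (h.scale.pos _) hda hdb (h.norm_sq_sub_one_le a) (h.norm_sq_sub_one_le b)
      hx' ((h.one_lt_norm w).le.trans hwx)
    rcases hnear with hn | hn
    · obtain ⟨hxa, ha⟩ := h.eq_end_of_nearEnd hS hw (by omega) hx hn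
      exact ⟨a, hxa, ha, .inl rfl⟩
    · obtain ⟨hxb, hb⟩ := h.eq_end_of_nearEnd hS hw (by omega) hx hn
      exact ⟨b, hxb, hb, .inr rfl⟩

theorem exists_common_end_of_isParent (h : IsFinePlacement S root δ Γ) {u w a b : V} {x : E}
    (hw : IsParent S root u w) (hb : IsParent S root a b) (hne : ¬ (u = a ∧ w = b))
    (hx : x ∈ segment ℝ (Γ u) (Γ w)) (hx' : x ∈ segment ℝ (Γ a) (Γ b)) :
    ∃ v, x = Γ v ∧ (v = u ∨ v = w) ∧ (v = a ∨ v = b) := by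
  rcases le_total (S.dist root a) (S.dist root u) with hle | hle
  · obtain ⟨hxu, hu⟩ := h.eq_or_eq_of_mem_edges hw hb hle hne hx hx'
    exact ⟨u, hxu, .inl rfl, hu⟩
  · obtain ⟨hxa, ha⟩ := h.eq_or_eq_of_mem_edges hb hw hle (by tauto) hx' hx
    exact ⟨a, hxa, ha, .inl rfl⟩

theorem exists_common_end (h : IsFinePlacement S root δ Γ) (hT : IsBFSTree G S root)
    {a b c d : V} {x : E} (hab : S.Adj a b) (hcd : G.Adj c d) (hne : s(a, b) ≠ s(c, d))
    (hx : x ∈ segment ℝ (Γ a) (Γ b)) (hx' : x ∈ segment ℝ (Γ c) (Γ d)) :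
    ∃ v, x = Γ v ∧ (v = a ∨ v = b) ∧ (v = c ∨ v = d) := by
  wlog hb : IsParent S root a b generalizing a b
  · have ha := (isParent_or_isParent_of_adj hT.isTree hab).resolve_left hb
    obtain ⟨v, hxv, hv, hv'⟩ := this hab.symm (Sym2.eq_swap.trans_ne hne)
      (segment_symm ℝ (Γ a) (Γ b) ▸ hx) ha
    exact ⟨v, hxv, hv.symm, hv'⟩
  wlog hlev : IsParent S root c d ∨ ¬ S.Adj c d ∧
      (S.dist root c = S.dist root d ∨ S.dist root d = S.dist root c + 1) generalizing c d
  · have hlev' : IsParent S root d c ∨ ¬ S.Adj d c ∧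
        (S.dist root d = S.dist root c ∨ S.dist root c = S.dist root d + 1) := by
      by_cases hS : S.Adj c d
      · have := isParent_or_isParent_of_adj (root := root) hT.isTree hS
        tauto
      · have := hT.levels c d hcd hS
        have := mt SimpleGraph.Adj.symm hS
        tauto
    obtain ⟨v, hxv, hv, hv'⟩ := this hcd.symm
      (segment_symm ℝ (Γ c) (Γ d) ▸ hx') (hne.trans_eq Sym2.eq_swap) hlev'
    exact ⟨v, hxv, hv, hv'.symm⟩
  rcases hlev with hd | ⟨hS, hlev⟩
  · exact h.exists_common_end_of_isParent hb hd (fun heq => hne (by rw [heq.1, heq.2])) hx hx'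
  · exact h.exists_common_end_of_not_adj hT.isTree.connected hb hS hcd.ne hlev hx hx'

theorem isCompatibleDrawing {Γ : V → Plane} (h : IsFinePlacement S root δ Γ)
    (hT : IsBFSTree G S root) : IsCompatibleDrawing G S Γ where
  drawing.injective := h.injective
  drawing.not_mem_edge a b w hab hwa hwb hw := by
    have : Nontrivial V := ⟨w, a, hwa⟩
    obtain ⟨z, hz⟩ := hT.isTree.connected.preconnected.exists_adj_of_nontrivial w
    have hne : s(w, z) ≠ s(a, b) := fun heq => by
      have := heq ▸ Sym2.mem_mk_left w z
      exact (Sym2.mem_iff.1 this).elim hwa hwb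
    obtain ⟨v, hwv, -, hv⟩ := h.exists_common_end hT hz hab hne (left_mem_segment ℝ _ _) hw
    obtain rfl := h.injective hwv
    exact hv.elim hwa hwb
  not_crossed a b c d hab hcd hne x hx := by
    obtain ⟨v, hxv, hv⟩ := h.exists_common_end hT hab hcd hne hx.1 hx.2
    exact ⟨v, hv, hxv.symm⟩

theorem levelsOnNestedCircles {Γ : V → Plane} (h : IsFinePlacement S root δ Γ) :
    LevelsOnNestedCircles S root Γ :=
  ⟨0, fun l => levelRadius (δ l),
    fun _ _ hij => levelRadius_lt_levelRadius (h.scale.pos _).le (h.scale.strictAnti hij),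
    fun l => one_pos.trans (one_lt_levelRadius (h.scale.pos l)),
    fun v => (dist_zero_right (Γ v)).trans (h.norm_eq v)⟩

end IsFinePlacement

end FinePlacement

section CirclePlacement

/-- The point of the circle of radius `r` about the origin with rational parameter `t`. -/
noncomputable def circlePoint (r t : ℝ) : Plane :=
  !₂[r * (2 * t / (1 + t ^ 2)), r * ((1 - t ^ 2) / (1 + t ^ 2))]

theorem norm_circlePoint {r : ℝ} (hr : 0 ≤ r) (t : ℝ) : ‖circlePoint r t‖ = r := by
  have : 1 + t ^ 2 ≠ 0 := by positivity
  refine (sq_eq_sq₀ (norm_nonneg _) hr).1 ?_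
  simp only [circlePoint, EuclideanSpace.norm_sq_eq, Fin.sum_univ_two, Real.norm_eq_abs, sq_abs,
    Matrix.cons_val_zero, Matrix.cons_val_one]
  field_simp
  ring

theorem norm_sq_circlePoint_sub (r r' s t : ℝ) :
    ‖circlePoint r s - circlePoint r' t‖ ^ 2 =
      (r - r') ^ 2 + r * r' * (4 * (s - t) ^ 2 / ((1 + s ^ 2) * (1 + t ^ 2))) := by
  have hs : 1 + s ^ 2 ≠ 0 := by positivity
  have ht : 1 + t ^ 2 ≠ 0 := by positivity
  simp only [circlePoint, EuclideanSpace.norm_sq_eq, Fin.sum_univ_two, Real.norm_eq_abs, sq_abs,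
    PiLp.sub_apply, Matrix.cons_val_zero, Matrix.cons_val_one]
  field_simp
  ring

theorem le_norm_circlePoint_sub {r s t : ℝ} (hr : 1 ≤ r) (hs : |s| ≤ 1) (ht : |t| ≤ 1) :
    |s - t| ≤ ‖circlePoint r s - circlePoint r t‖ := by
  rw [← sq_le_sq₀ (abs_nonneg _) (norm_nonneg _), norm_sq_circlePoint_sub, sq_abs]
  have hs_sq : s ^ 2 ≤ 1 := (sq_le_one_iff_abs_le_one s).2 hs
  have ht_sq : t ^ 2 ≤ 1 := (sq_le_one_iff_abs_le_one t).2 ht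
  have hden : (1 + s ^ 2) * (1 + t ^ 2) ≤ 2 * 2 := by gcongr <;> linarith
  have hchord : (s - t) ^ 2 ≤ 4 * (s - t) ^ 2 / ((1 + s ^ 2) * (1 + t ^ 2)) := by
    rw [le_div_iff₀ (by positivity)]
    nlinarith [sq_nonneg (s - t)]
  nlinarith [sq_nonneg (s - t), mul_le_mul hr hr zero_le_one (by linarith)]

theorem norm_circlePoint_sub_le {r r' : ℝ} (s t : ℝ) (hr₀ : 0 ≤ r) (hr : r ≤ 2) (hr' : r' ≤ 2) :
    ‖circlePoint r s - circlePoint r' t‖ ≤ |r - r'| + 4 * |s - t| := by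
  rw [← sq_le_sq₀ (norm_nonneg _) (by positivity), norm_sq_circlePoint_sub]
  have hden : 1 ≤ (1 + s ^ 2) * (1 + t ^ 2) :=
    one_le_mul_of_one_le_of_one_le (by linarith [sq_nonneg s]) (by linarith [sq_nonneg t])
  have hchord : 4 * (s - t) ^ 2 / ((1 + s ^ 2) * (1 + t ^ 2)) ≤ 4 * (s - t) ^ 2 :=
    div_le_self (by positivity) hden
  have hrr : r * r' ≤ 4 := by nlinarith
  calc (r - r') ^ 2 + r * r' * (4 * (s - t) ^ 2 / ((1 + s ^ 2) * (1 + t ^ 2)))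
      ≤ (r - r') ^ 2 + 4 * (4 * (s - t) ^ 2) := by gcongr
    _ = |r - r'| ^ 2 + (4 * |s - t|) ^ 2 := by rw [mul_pow, sq_abs, sq_abs]; ring
    _ ≤ (|r - r'| + 4 * |s - t|) ^ 2 := by
      rw [add_sq]
      have : 0 ≤ 2 * |r - r'| * (4 * |s - t|) := by positivity
      linarith

/-- The separation of the parameters on level `l`. The quotient `levelScale q l ^ 2 / q` leaves room
for a family of children, at multiples up to `q / 1024` of that separation, within a distance small
compared to the square of the scale of the parent. -/
noncomputable def levelScale (q : ℝ) : ℕ → ℝ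
  | 0 => 1
  | l + 1 => levelScale q l ^ 2 / q

section levelScale

variable {q : ℝ}

theorem levelScale_pos (hq : 0 < q) (l : ℕ) : 0 < levelScale q l := by
  induction l with
  | zero => exact one_pos
  | succ l ih => exact div_pos (pow_pos ih 2) hq

theorem levelScale_one (q : ℝ) : levelScale q 1 = 1 / q := by
  rw [levelScale, levelScale, one_pow]

theorem mul_levelScale_succ (hq : q ≠ 0) (l : ℕ) :
    q * levelScale q (l + 1) = levelScale q l ^ 2 :=
  mul_div_cancel₀ _ hq

theorem levelScale_le_one (hq : 1 ≤ q) (l : ℕ) : levelScale q l ≤ 1 := by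
  induction l with
  | zero => exact le_rfl
  | succ l ih =>
    rw [levelScale, div_le_one (by linarith)]
    exact (pow_le_one₀ (levelScale_pos (by linarith) l).le ih).trans hq

theorem mul_levelScale_succ_le (hq : 1 ≤ q) (l : ℕ) :
    q * levelScale q (l + 1) ≤ levelScale q l := by
  rw [mul_levelScale_succ (by linarith)]
  exact pow_le_of_le_one (levelScale_pos (by linarith) l).le (levelScale_le_one hq l) two_ne_zero

theorem isLevelScale_levelScale (hq : 8 ≤ q) : IsLevelScale (levelScale q) where
  pos := levelScale_pos (by linarith)
  zero_le_one := le_rfl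
  succ_le l := by
    have hpos := levelScale_pos (show 0 < q by linarith) (l + 1)
    exact (mul_le_mul_of_nonneg_right hq hpos.le).trans (mul_levelScale_succ_le (by linarith) l)

end levelScale

variable {V : Type u}

/-- `t` assigns to the vertices parameters on their circles: the parameter of a child exceeds that
of its parent by the scale of its level, times a multiplier `f` that is at most `N` and that differs
from vertex to vertex by at least `1`. -/
structure IsParameterization (S : SimpleGraph V) (root : V) (N q : ℝ) (f t : V → ℝ) : Prop where
  one_le : ∀ v, 1 ≤ f v
  le : ∀ v, f v ≤ N
  sep : ∀ v w, v ≠ w → 1 ≤ |f v - f w|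
  le_q : 1024 * (N + 1) ≤ q
  root_eq : t root = 0
  child_eq : ∀ p v, IsParent S root p v → t v = t p + f v * levelScale q (S.dist root v)

/-- The drawing given by parameters of the vertices on the circles of their levels. -/
noncomputable def placement (S : SimpleGraph V) (root : V) (q : ℝ) (t : V → ℝ) (v : V) : Plane :=
  circlePoint (levelRadius (levelScale q (S.dist root v))) (t v)

namespace IsParameterization

variable {S : SimpleGraph V} {root : V} {N q : ℝ} {f t : V → ℝ}

theorem one_le_N (h : IsParameterization S root N q f t) : 1 ≤ N :=
  (h.one_le root).trans (h.le root)

theorem le_scaleFactor (h : IsParameterization S root N q f t) : 2048 ≤ q := by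
  linarith [h.one_le_N, h.le_q]

theorem levelScale_pos (h : IsParameterization S root N q f t) (l : ℕ) : 0 < levelScale q l :=
  _root_.levelScale_pos (by linarith [h.le_scaleFactor]) l

theorem mul_levelScale_succ_le (h : IsParameterization S root N q f t) (l : ℕ) :
    1024 * (N + 1) * levelScale q (l + 1) ≤ levelScale q l :=
  (mul_le_mul_of_nonneg_right h.le_q (h.levelScale_pos _).le).trans
    (_root_.mul_levelScale_succ_le (by linarith [h.le_scaleFactor]) l)

theorem mul_levelScale_succ_le_sq (h : IsParameterization S root N q f t) (l : ℕ) :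
    1024 * (N + 1) * levelScale q (l + 1) ≤ levelScale q l ^ 2 :=
  (mul_le_mul_of_nonneg_right h.le_q (h.levelScale_pos _).le).trans_eq
    (mul_levelScale_succ (by linarith [h.le_scaleFactor]) l)

theorem le_child (h : IsParameterization S root N q f t) {p v : V} (hv : IsParent S root p v) :
    t p ≤ t v := by
  rw [h.child_eq p v hv]
  have := h.one_le v
  have := h.levelScale_pos (S.dist root v)
  exact le_add_of_nonneg_right (by positivity)

theorem child_le (h : IsParameterization S root N q f t) {p v : V} (hv : IsParent S root p v) :
    t v ≤ t p + N * levelScale q (S.dist root v) := by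
  rw [h.child_eq p v hv]
  have := h.levelScale_pos (S.dist root v)
  gcongr
  exact h.le v

theorem nonneg (h : IsParameterization S root N q f t) (hS : S.Connected) (v : V) : 0 ≤ t v := by
  induction hl : S.dist root v generalizing v with
  | zero => rw [← hS.dist_eq_zero_iff.1 hl, h.root_eq]
  | succ l ih =>
    obtain ⟨p, hp⟩ := exists_isParent hS (v := v) (root := root) (by rintro rfl; simp at hl)
    exact (ih p (by have := hp.2; omega)).trans (h.le_child hp)

/-- The increments along a branch at least halve from each level to the next; the subtracted term
bounds those still to come. -/
theorem le_two_mul_sub (h : IsParameterization S root N q f t) (hS : S.Connected) (v : V) :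
    t v ≤ 2 * N * levelScale q 1 - 2 * N * levelScale q (S.dist root v + 1) := by
  induction hl : S.dist root v generalizing v with
  | zero => rw [← hS.dist_eq_zero_iff.1 hl, h.root_eq, zero_add, sub_self]
  | succ l ih =>
    obtain ⟨p, hp⟩ := exists_isParent hS (v := v) (root := root) (by rintro rfl; simp at hl)
    have hN := h.one_le_N
    have hparent := ih p (by have := hp.2; omega)
    have hchild := h.child_le hp
    have hpos := h.levelScale_pos (l + 2)
    have hhalf : 2 * levelScale q (l + 2) ≤ levelScale q (l + 1) := by
      nlinarith [h.mul_levelScale_succ_le (l + 1)]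
    rw [hl] at hchild
    nlinarith

theorem le_inv (h : IsParameterization S root N q f t) (hS : S.Connected) (v : V) :
    t v ≤ 1 / 512 := by
  have hN := h.one_le_N
  have hpos := h.levelScale_pos (S.dist root v + 1)
  have hfirst : 1024 * (N + 1) * levelScale q 1 ≤ 1 := h.mul_levelScale_succ_le 0
  nlinarith [h.le_two_mul_sub hS v, h.levelScale_pos 1]

theorem abs_le_one (h : IsParameterization S root N q f t) (hS : S.Connected) (v : V) :
    |t v| ≤ 1 := by
  rw [abs_of_nonneg (h.nonneg hS v)]
  linarith [h.le_inv hS v]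

theorem abs_multiplier_sub_le (h : IsParameterization S root N q f t) (v w : V) :
    |f v - f w| ≤ N :=
  abs_le.2 ⟨by linarith [h.one_le v, h.le w], by linarith [h.one_le w, h.le v]⟩

theorem levelScale_le_abs_sub (h : IsParameterization S root N q f t) (hS : S.Connected) {v w : V}
    (hne : v ≠ w) (hvw : S.dist root v = S.dist root w) :
    levelScale q (S.dist root v) ≤ |t v - t w| := by
  induction hl : S.dist root v generalizing v w with
  | zero =>
    rw [hl] at hvw
    exact absurd ((hS.dist_eq_zero_iff.1 hl).symm.trans (hS.dist_eq_zero_iff.1 hvw.symm)) hne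
  | succ l ih =>
    rw [hl] at hvw
    obtain ⟨p, hp⟩ := exists_isParent hS (v := v) (root := root) (by rintro rfl; simp at hl)
    obtain ⟨p', hp'⟩ := exists_isParent hS (v := w) (root := root) (by rintro rfl; simp at hvw)
    have hpos := h.levelScale_pos (l + 1)
    rw [h.child_eq p v hp, h.child_eq p' w hp', hl, ← hvw]
    have hp_dist := hp.2
    have hp'_dist := hp'.2
    rcases eq_or_ne p p' with rfl | hpp
    · rw [add_sub_add_left_eq_sub, ← sub_mul, abs_mul, abs_of_pos hpos]
      exact le_mul_of_one_le_left hpos.le (h.sep v w hne)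
    · have hparents := ih hpp (by omega) (by omega)
      have hsteps : |(f w - f v) * levelScale q (l + 1)| ≤ N * levelScale q (l + 1) := by
        rw [abs_mul, abs_of_pos hpos]
        exact mul_le_mul_of_nonneg_right (h.abs_multiplier_sub_le w v) hpos.le
      have hscale := h.mul_levelScale_succ_le l
      have hN := mul_pos (one_pos.trans_le h.one_le_N) hpos
      rw [show ∀ a b c d e : ℝ, a + b * e - (c + d * e) = (a - c) - (d - b) * e by intros; ring]
      linarith [abs_sub_abs_le_abs_sub (t p - t p') ((f w - f v) * levelScale q (l + 1))]

theorem isLevelScale (h : IsParameterization S root N q f t) : IsLevelScale (levelScale q) :=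
  isLevelScale_levelScale (by linarith [h.le_scaleFactor])

theorem one_lt_levelRadius (h : IsParameterization S root N q f t) (l : ℕ) :
    1 < levelRadius (levelScale q l) :=
  _root_.one_lt_levelRadius (h.levelScale_pos l)

theorem levelRadius_le (h : IsParameterization S root N q f t) (l : ℕ) :
    levelRadius (levelScale q l) ≤ 1 + 1 / 256 := by
  rw [levelRadius]
  gcongr
  exact pow_le_one₀ (h.levelScale_pos l).le (h.isLevelScale.le_one l)

theorem norm_placement_sub_le (h : IsParameterization S root N q f t) (a b : V) :
    ‖placement S root q t b - placement S root q t a‖ ≤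
      |levelRadius (levelScale q (S.dist root b)) - levelRadius (levelScale q (S.dist root a))| +
        4 * |t b - t a| :=
  norm_circlePoint_sub_le _ _ (by linarith [h.one_lt_levelRadius (S.dist root b)])
    (by linarith [h.levelRadius_le (S.dist root b)])
    (by linarith [h.levelRadius_le (S.dist root a)])

theorem norm_placement_sub_lt (h : IsParameterization S root N q f t) (hS : S.Connected)
    (a b : V) : ‖placement S root q t b - placement S root q t a‖ < 1 / 8 := by
  refine (h.norm_placement_sub_le a b).trans_lt ?_
  have hradii := abs_sub_le_of_le_of_le (h.one_lt_levelRadius (S.dist root b)).le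
    (h.levelRadius_le (S.dist root b)) (h.one_lt_levelRadius (S.dist root a)).le
    (h.levelRadius_le (S.dist root a))
  have hparams := abs_sub_le_of_nonneg_of_le (h.nonneg hS b) (h.le_inv hS b)
    (h.nonneg hS a) (h.le_inv hS a)
  linarith

theorem norm_placement_edge_le (h : IsParameterization S root N q f t) {p v : V}
    (hv : IsParent S root p v) :
    ‖placement S root q t v - placement S root q t p‖ ≤
      levelScale q (S.dist root p) ^ 2 / 128 := by
  refine (h.norm_placement_sub_le p v).trans ?_
  have hradii : |levelRadius (levelScale q (S.dist root v)) -
      levelRadius (levelScale q (S.dist root p))| ≤ levelScale q (S.dist root p) ^ 2 / 256 := by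
    have hsq := h.isLevelScale.succ_sq_le (S.dist root p)
    rw [hv.2, levelRadius, levelRadius, abs_le]
    constructor <;> linarith [sq_nonneg (levelScale q (S.dist root p + 1))]
  have hparams : |t v - t p| ≤ N * levelScale q (S.dist root v) := by
    rw [abs_of_nonneg (by linarith [h.le_child hv])]
    linarith [h.child_le hv]
  have hscale := h.mul_levelScale_succ_le_sq (S.dist root p)
  rw [hv.2] at hparams
  linarith [h.levelScale_pos (S.dist root p + 1)]

theorem isFinePlacement (h : IsParameterization S root N q f t) (hS : S.Connected) :
    IsFinePlacement S root (levelScale q) (placement S root q t) where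
  scale := h.isLevelScale
  norm_eq v := norm_circlePoint (by linarith [h.one_lt_levelRadius (S.dist root v)]) _
  diam := h.norm_placement_sub_lt hS
  sep a b hne hab := by
    rw [placement, placement, hab]
    exact (h.levelScale_le_abs_sub hS hne.symm hab.symm).trans
      (le_norm_circlePoint_sub (h.one_lt_levelRadius _).le (h.abs_le_one hS b) (h.abs_le_one hS a))
  edge _ _ hv := h.norm_placement_edge_le hv

end IsParameterization

theorem one_le_abs_natCast_sub {a b : ℕ} (h : a ≠ b) : (1 : ℝ) ≤ |(a : ℝ) - b| := by
  exact_mod_cast Int.one_le_abs (sub_ne_zero.2 (Nat.cast_injective.ne h) : (a : ℤ) - b ≠ 0)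

theorem exists_isParameterization [Finite V] {S : SimpleGraph V} (hS : S.IsTree) (root : V) :
    ∃ (N q : ℝ) (f t : V → ℝ), IsParameterization S root N q f t := by
  obtain ⟨n, ⟨e⟩⟩ := Finite.exists_equiv_fin V
  obtain ⟨t, hroot, ht⟩ := exists_potential hS root
    fun v => ((e v + 1 : ℕ) : ℝ) * levelScale (1024 * (n + 1)) (S.dist root v)
  refine ⟨n, 1024 * (n + 1), fun v => (e v + 1 : ℕ), t, fun v => ?_, fun v => ?_,
    fun v w hne => one_le_abs_natCast_sub fun h => hne ?_, le_rfl, hroot, ht⟩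
  · exact_mod_cast Nat.le_add_left 1 (e v)
  · exact_mod_cast (e v).isLt
  · exact e.injective (Fin.val_injective (Nat.add_right_cancel h))

theorem exists_compatible_drawing [Finite V] {G S : SimpleGraph V} {root : V}
    (h : IsBFSTree G S root) :
    ∃ Γ : V → Plane, IsCompatibleDrawing G S Γ ∧ LevelsOnNestedCircles S root Γ := by
  obtain ⟨N, q, f, t, ht⟩ := exists_isParameterization h.isTree root
  have hfine := ht.isFinePlacement h.isTree.connected
  exact ⟨_, hfine.isCompatibleDrawing h, hfine.levelsOnNestedCircles⟩

end CirclePlacement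

section StructuredPrograms

namespace RealRAM

/-- `P` takes `t` steps from the configuration `c` to the configuration `c'`. -/
def StepsTo (P : Program) (x : ℕ → ℕ) (t : ℕ) (c c' : Config) : Prop :=
  (fun o => o.bind (step P x))^[t] (some c) = some c'

namespace StepsTo

variable {P : Program} {x : ℕ → ℕ} {t t' : ℕ} {c c' c'' : Config}

theorem refl (c : Config) : StepsTo P x 0 c c := rfl

theorem trans (h : StepsTo P x t c c') (h' : StepsTo P x t' c' c'') :
    StepsTo P x (t + t') c c'' := by
  rw [StepsTo, add_comm, Function.iterate_add_apply, h]
  exact h'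

theorem of_step {i : Instr} (hi : P[c.pc]? = some i) (h : exec x c i = some c') :
    StepsTo P x 1 c c' := by
  simpa [StepsTo, step, hi] using h

theorem haltsWith (h : StepsTo P x t .init c) (hc : P[c.pc]? = some .halt) :
    HaltsWith P x t c.out := by
  refine ⟨c, Eq.trans ?_ h, hc, rfl⟩
  clear h hc
  induction t with
  | zero => rfl
  | succ t ih => rw [run, ih, Function.iterate_succ_apply']

end StepsTo

/-- The contents of the two memories and of the output array. -/
structure Mem : Type where
  I : ℕ → ℕ
  R : ℕ → ℝ
  out : ℕ → ℝ

/-- The configuration with given memory contents and program counter. -/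
def Mem.toConfig (s : Mem) (pc : ℕ) : Config := ⟨pc, s.I, s.R, s.out⟩

theorem StepsTo.ijump_of_le {P : Program} {x : ℕ → ℕ} {s : Mem} {a b k l : ℕ}
    (hP : P[k]? = some (.ijump a b l)) (h : s.I a ≤ s.I b) :
    StepsTo P x 1 (s.toConfig k) (s.toConfig l) :=
  .of_step hP (by rw [exec, if_pos (by exact h)]; rfl)

theorem StepsTo.ijump_of_not_le {P : Program} {x : ℕ → ℕ} {s : Mem} {a b k l : ℕ}
    (hP : P[k]? = some (.ijump a b l)) (h : ¬ s.I a ≤ s.I b) :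
    StepsTo P x 1 (s.toConfig k) (s.toConfig (k + 1)) :=
  .of_step hP (by rw [exec, if_neg (by exact h)]; rfl)

/-- Whether an instruction passes control to the next one. -/
def Instr.isStraight : Instr → Bool
  | .ijump .. | .rjump .. | .halt => false
  | _ => true

/-- The effect of an instruction on the memory. -/
noncomputable def stepMem (x : ℕ → ℕ) (s : Mem) (i : Instr) : Option Mem :=
  (exec x (s.toConfig 0) i).map fun c => ⟨c.I, c.R, c.out⟩

theorem exec_of_stepMem {x : ℕ → ℕ} {s s' : Mem} {i : Instr} (hi : i.isStraight)
    (h : stepMem x s i = some s') (pc : ℕ) :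
    exec x (s.toConfig pc) i = some (s'.toConfig (pc + 1)) := by
  obtain ⟨c, hc, rfl⟩ := Option.map_eq_some_iff.1 h
  cases i with
  | ijump | rjump | halt => cases hi
  | rdiv d a b =>
    rw [exec] at hc ⊢
    split_ifs at hc with hb
    exact (if_neg hb).trans (Option.some.inj hc ▸ rfl)
  | _ => exact Option.some.inj hc ▸ rfl

/-- Programs with structured control flow: straight-line code, composition, branching on
`I[a] ≤ I[b]`, and a loop that is left as soon as `I[a] ≤ I[b]`. -/
inductive Code : Type
  | block (is : List Instr)
  | seq (p q : Code)
  | ifLE (a b : ℕ) (p q : Code)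
  | untilLE (a b : ℕ) (p : Code)

namespace Code

/-- The number of instructions of the compiled code. -/
def size : Code → ℕ
  | block is => is.length
  | seq p q => p.size + q.size
  | ifLE _ _ p q => q.size + p.size + 2
  | untilLE _ _ p => p.size + 2

/-- The instructions of structured code that is placed at position `k` of a program. The jump
`ijump 0 0 l` is unconditional. -/
def compile : Code → ℕ → List Instr
  | block is, _ => is
  | seq p q, k => p.compile k ++ q.compile (k + p.size)
  | ifLE a b p q, k =>
      .ijump a b (k + q.size + 2) :: (q.compile (k + 1) ++
        .ijump 0 0 (k + (q.size + p.size + 2)) :: p.compile (k + q.size + 2))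
  | untilLE a b p, k =>
      .ijump a b (k + (p.size + 2)) :: (p.compile (k + 1) ++ [.ijump 0 0 k])

theorem length_compile (p : Code) (k : ℕ) : (p.compile k).length = p.size := by
  induction p generalizing k with
  | block is => rfl
  | seq p q hp hq => rw [compile, List.length_append, hp, hq, size]
  | ifLE a b p q hp hq =>
    simp only [compile, size, List.length_cons, List.length_append, hp, hq]
    omega
  | untilLE a b p hp =>
    simp only [compile, size, List.length_cons, List.length_append, List.length_nil, hp]

end Code

/-- From position `k` on, the instructions of `P` are those of `l`, followed by arbitrary others. -/
def OccursAt (P : Program) (k : ℕ) (l : List Instr) : Prop :=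
  l <+: P.drop k

namespace OccursAt

variable {P : Program} {k : ℕ} {i : Instr} {l l' : List Instr}

theorem append (h : OccursAt P k (l ++ l')) : OccursAt P k l ∧ OccursAt P (k + l.length) l' := by
  obtain ⟨r, hr⟩ := h
  refine ⟨⟨l' ++ r, by rw [← hr, List.append_assoc]⟩, ⟨r, ?_⟩⟩
  rw [← List.drop_drop, ← hr, List.append_assoc, List.drop_left]

theorem cons (h : OccursAt P k (i :: l)) : P[k]? = some i ∧ OccursAt P (k + 1) l := by
  refine ⟨?_, (append (l := [i]) h).2⟩
  obtain ⟨r, hr⟩ := h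
  rw [← Nat.add_zero k, ← List.getElem?_drop, ← hr]
  rfl

end OccursAt

/-- The code `p` runs for `t` steps and turns the memory `s` into `s'`, in every program that
contains it. -/
def Code.Runs (x : ℕ → ℕ) (p : Code) (s : Mem) (t : ℕ) (s' : Mem) : Prop :=
  ∀ (P : Program) (k : ℕ), OccursAt P k (p.compile k) →
    StepsTo P x t (s.toConfig k) (s'.toConfig (k + p.size))

namespace Code.Runs

variable {x : ℕ → ℕ} {p q : Code} {a b t t' : ℕ} {s s' s'' : Mem}

theorem block {is : List Instr} (hi : is.all Instr.isStraight)
    (h : is.foldlM (stepMem x) s = some s') : (Code.block is).Runs x s is.length s' := by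
  intro P k hP
  simp only [compile, size] at hP ⊢
  induction is generalizing s k with
  | nil => exact Option.some.inj h ▸ .refl _
  | cons i is ih =>
    obtain ⟨s₁, hs₁, h⟩ := Option.bind_eq_some_iff.1 h
    rw [List.all_cons, Bool.and_eq_true] at hi
    rw [List.length_cons, add_comm is.length, ← add_assoc]
    exact .trans (.of_step hP.cons.1 (exec_of_stepMem hi.1 hs₁ k)) (ih hi.2 h (k + 1) hP.cons.2)

theorem seq (hp : p.Runs x s t s') (hq : q.Runs x s' t' s'') :
    (Code.seq p q).Runs x s (t + t') s'' := by
  intro P k hP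
  have hP' := hP.append
  rw [length_compile] at hP'
  rw [size, ← add_assoc]
  exact (hp P k hP'.1).trans (hq P _ hP'.2)

theorem ifLE_of_le (h : s.I a ≤ s.I b) (hp : p.Runs x s t s') :
    (Code.ifLE a b p q).Runs x s (t + 1) s' := by
  intro P k hP
  have hp_occurs := hP.cons.2.append.2.cons.2
  rw [length_compile, show k + 1 + q.size + 1 = k + q.size + 2 by ring] at hp_occurs
  rw [size, show k + (q.size + p.size + 2) = k + q.size + 2 + p.size by ring, add_comm]
  exact (StepsTo.ijump_of_le hP.cons.1 h).trans (hp P _ hp_occurs)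

theorem ifLE_of_not_le (h : ¬ s.I a ≤ s.I b) (hq : q.Runs x s t s') :
    (Code.ifLE a b p q).Runs x s (t + 2) s' := by
  intro P k hP
  have hjump := hP.cons.2.append.2.cons.1
  rw [length_compile] at hjump
  rw [show t + 2 = 1 + t + 1 by ring]
  exact ((StepsTo.ijump_of_not_le hP.cons.1 h).trans (hq P _ hP.cons.2.append.1)).trans
    (.ijump_of_le hjump le_rfl)

theorem untilLE_of_le (h : s.I a ≤ s.I b) : (Code.untilLE a b p).Runs x s 1 s :=
  fun _ _ hP => .ijump_of_le hP.cons.1 h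

theorem untilLE_of_not_le (h : ¬ s.I a ≤ s.I b) (hp : p.Runs x s t s')
    (hloop : (Code.untilLE a b p).Runs x s' t' s'') :
    (Code.untilLE a b p).Runs x s (t + 2 + t') s'' := by
  intro P k hP
  have hjump := hP.cons.2.append.2.cons.1
  rw [length_compile] at hjump
  rw [show t + 2 = 1 + t + 1 by ring]
  exact (((StepsTo.ijump_of_not_le hP.cons.1 h).trans (hp P _ hP.cons.2.append.1)).trans
    (.ijump_of_le hjump le_rfl)).trans (hloop P k hP)

end Code.Runs

/-- Started on the memory `s`, the code `p` ends within `T` steps, with a memory that satisfies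
`Q`. -/
def Code.Achieves (x : ℕ → ℕ) (p : Code) (s : Mem) (T : ℕ) (Q : Mem → Prop) : Prop :=
  ∃ t ≤ T, ∃ s', p.Runs x s t s' ∧ Q s'

namespace Code.Achieves

variable {x : ℕ → ℕ} {p q : Code} {a b T T' : ℕ} {s : Mem} {Q Q' : Mem → Prop}

theorem mono (h : p.Achieves x s T Q) (hT : T ≤ T') : p.Achieves x s T' Q := by
  obtain ⟨t, ht, h⟩ := h
  exact ⟨t, ht.trans hT, h⟩

theorem imp (h : p.Achieves x s T Q) (hQ : ∀ s', Q s' → Q' s') : p.Achieves x s T Q' := by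
  obtain ⟨t, ht, s', hs', h⟩ := h
  exact ⟨t, ht, s', hs', hQ s' h⟩

theorem block {is : List Instr} (hi : is.all Instr.isStraight)
    (h : ∃ s', is.foldlM (stepMem x) s = some s' ∧ Q s') :
    (Code.block is).Achieves x s is.length Q := by
  obtain ⟨s', hs', h⟩ := h
  exact ⟨_, le_rfl, s', .block hi hs', h⟩

theorem seq (hp : p.Achieves x s T Q) (hq : ∀ s', Q s' → q.Achieves x s' T' Q') :
    (Code.seq p q).Achieves x s (T + T') Q' := by
  obtain ⟨t, ht, s', hs', h⟩ := hp
  obtain ⟨t', ht', s'', hs'', h'⟩ := hq s' h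
  exact ⟨t + t', add_le_add ht ht', s'', hs'.seq hs'', h'⟩

theorem ifLE (hp : s.I a ≤ s.I b → p.Achieves x s T Q)
    (hq : ¬ s.I a ≤ s.I b → q.Achieves x s T Q) : (Code.ifLE a b p q).Achieves x s (T + 2) Q := by
  by_cases h : s.I a ≤ s.I b
  · obtain ⟨t, ht, s', hs', h'⟩ := hp h
    exact ⟨t + 1, by omega, s', hs'.ifLE_of_le h, h'⟩
  · obtain ⟨t, ht, s', hs', h'⟩ := hq h
    exact ⟨t + 2, by omega, s', hs'.ifLE_of_not_le h, h'⟩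

/-- The invariant `Inv` may mention data `i` that the memory does not determine; the running time is
bounded by a potential `φ` of these data. -/
theorem untilLE {ι : Type*} {Inv : ι → Mem → Prop} (φ : ι → ℕ)
    (hbody : ∀ i s, Inv i s → ¬ s.I a ≤ s.I b →
      p.Achieves x s T fun s' => ∃ j, φ j < φ i ∧ Inv j s')
    {i : ι} (h : Inv i s) :
    (Code.untilLE a b p).Achieves x s (φ i * (T + 2) + 1)
      fun s' => ∃ j, Inv j s' ∧ s'.I a ≤ s'.I b := by
  induction hφ : φ i using Nat.strong_induction_on generalizing i s with
  | _ k ih =>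
    subst hφ
    by_cases hab : s.I a ≤ s.I b
    · exact ⟨1, by omega, s, .untilLE_of_le hab, i, h, hab⟩
    · obtain ⟨t, ht, s', hs', j, hj, hInv⟩ := hbody i s h hab
      obtain ⟨t', ht', s'', hs'', h''⟩ := ih (φ j) hj hInv rfl
      refine ⟨t + 2 + t', ?_, s'', .untilLE_of_not_le hab hs' hs'', h''⟩
      calc t + 2 + t' ≤ (T + 2) + (φ j * (T + 2) + 1) := by gcongr
        _ = (φ j + 1) * (T + 2) + 1 := by ring
        _ ≤ φ i * (T + 2) + 1 := by gcongr; exact hj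

theorem exists_haltsWith {p : Code} (h : p.Achieves x ⟨fun _ => 0, fun _ => 0, fun _ => 0⟩ T Q) :
    ∃ t ≤ T, ∃ s, HaltsWith (p.compile 0 ++ [.halt]) x t s.out ∧ Q s := by
  obtain ⟨t, ht, s, hs, h⟩ := h
  have hP : OccursAt (p.compile 0 ++ [.halt]) 0 (p.compile 0) := List.prefix_append _ _
  refine ⟨t, ht, s, (hs _ 0 hP).haltsWith ?_, h⟩
  rw [Mem.toConfig, Nat.zero_add, ← length_compile p 0, List.getElem?_concat_length]

end Code.Achieves

end RealRAM

end StructuredPrograms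

section LeafPruning

variable {V : Type u}

/-- After the removal of the vertices in `W`, the vertex `u` is a leaf of the tree `S` other than
the root. -/
structure IsPrunable (S : SimpleGraph V) (root : V) (W : List V) (u : V) : Prop where
  ne_root : u ≠ root
  notMem : u ∉ W
  mem_of_isParent : ∀ w, IsParent S root u w → w ∈ W

/-- The vertices in `W`, from the last to the first, can be removed from the tree `S` one after the
other as leaves. -/
inductive IsPruning (S : SimpleGraph V) (root : V) : List V → Prop
  | nil : IsPruning S root []
  | cons {W : List V} {u : V} (hW : IsPruning S root W) (hu : IsPrunable S root W u) :
      IsPruning S root (u :: W)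

variable {S : SimpleGraph V} {root u v p : V} {W : List V}

namespace IsPruning

theorem mem_of_isParent (hW : IsPruning S root W) (hp : p ∈ W) (hv : IsParent S root p v) :
    v ∈ W := by
  induction hW with
  | nil => cases hp
  | cons _ hu ih =>
    rcases List.mem_cons.1 hp with rfl | hp
    · exact List.mem_cons_of_mem _ (hu.mem_of_isParent v hv)
    · exact List.mem_cons_of_mem _ (ih hp)

theorem root_notMem (hW : IsPruning S root W) : root ∉ W := by
  induction hW with
  | nil => exact List.not_mem_nil
  | cons _ hu ih => exact List.not_mem_cons_of_ne_of_not_mem hu.ne_root.symm ih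

theorem nodup (hW : IsPruning S root W) : W.Nodup := by
  induction hW with
  | nil => exact List.nodup_nil
  | cons _ hu ih => exact List.nodup_cons.2 ⟨hu.notMem, ih⟩

theorem length_lt [Fintype V] (hW : IsPruning S root W) : W.length < Fintype.card V := by
  simpa using (List.nodup_cons.2 ⟨hW.root_notMem, hW.nodup⟩).length_le_card

end IsPruning

theorem exists_isPrunable [Finite V] (hv : v ≠ root) (hvW : v ∉ W) :
    ∃ u, IsPrunable S root W u := by
  have hne : {v | v ≠ root ∧ v ∉ W}.Nonempty := ⟨v, hv, hvW⟩
  obtain ⟨u, hu, hmax⟩ := Set.exists_max_image _ (S.dist root) (Set.toFinite _) hne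
  refine ⟨u, hu.1, hu.2, fun w hw => by_contra fun hwW => ?_⟩
  have := hmax w ⟨hw.ne_root, hwW⟩
  have := hw.2
  omega

namespace IsPrunable

theorem parent_notMem (hu : IsPrunable S root W u) (hW : IsPruning S root W)
    (hp : IsParent S root p u) : p ∉ u :: W :=
  List.not_mem_cons_of_ne_of_not_mem hp.1.ne fun hpW =>
    hu.notMem (hW.mem_of_isParent hpW hp)

theorem of_cons (hv : IsPrunable S root (u :: W) v) (hvu : ¬ IsParent S root v u) :
    IsPrunable S root W v :=
  ⟨hv.ne_root, fun hvW => hv.notMem (List.mem_cons_of_mem _ hvW), fun w hw =>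
    (List.mem_cons.1 (hv.mem_of_isParent w hw)).resolve_left fun h => hvu (h ▸ hw)⟩

end IsPrunable

variable [Fintype V]

open Classical in
/-- The neighbours of `v` that are not in `W`. -/
noncomputable def neighborsOutside (S : SimpleGraph V) (W : List V) (v : V) : Finset V :=
  {w | S.Adj v w ∧ w ∉ W}

theorem mem_neighborsOutside {w : V} : w ∈ neighborsOutside S W v ↔ S.Adj v w ∧ w ∉ W := by
  simp [neighborsOutside]

theorem IsPrunable.neighborsOutside_eq (hu : IsPrunable S root W u) (hS : S.IsTree)
    (hW : IsPruning S root W) (hp : IsParent S root p u) : neighborsOutside S W u = {p} := by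
  ext w
  rw [mem_neighborsOutside, Finset.mem_singleton]
  refine ⟨fun ⟨huw, hw⟩ => ?_, ?_⟩
  · rcases isParent_or_isParent_of_adj (root := root) hS huw with hw' | hw'
    · exact absurd (hu.mem_of_isParent w hw') hw
    · exact hw'.eq hS hp
  · rintro rfl
    exact ⟨hp.1.symm, List.not_mem_of_not_mem_cons (hu.parent_notMem hW hp)⟩

theorem IsPruning.isPrunable_of_card_lt_two (hW : IsPruning S root W) (hS : S.Connected)
    (hv : v ≠ root) (hvW : v ∉ W) (hcard : (neighborsOutside S W v).card < 2) :
    IsPrunable S root W v := by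
  refine ⟨hv, hvW, fun w hw => by_contra fun hwW => hcard.not_ge ?_⟩
  obtain ⟨p, hp⟩ := exists_isParent hS hv
  have hp_mem : p ∈ neighborsOutside S W v :=
    mem_neighborsOutside.2 ⟨hp.1.symm, fun hpW => hvW (hW.mem_of_isParent hpW hp)⟩
  have hw_mem : w ∈ neighborsOutside S W v := mem_neighborsOutside.2 ⟨hw.1, hwW⟩
  refine Finset.one_lt_card.2 ⟨p, hp_mem, w, hw_mem, ?_⟩
  rintro rfl
  have := hp.2
  have := hw.2
  omega

theorem neighborsOutside_cons [DecidableEq V] (u v : V) :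
    neighborsOutside S (u :: W) v = (neighborsOutside S W v).erase u := by
  ext w
  simp only [mem_neighborsOutside, Finset.mem_erase, List.mem_cons]
  tauto

theorem IsPrunable.notMem_neighborsOutside (hu : IsPrunable S root W u) (hS : S.IsTree)
    (hv : v ∉ W) (hvu : ¬ IsParent S root v u) : u ∉ neighborsOutside S W v := fun h =>
  (isParent_or_isParent_of_adj hS (mem_neighborsOutside.1 h).1).elim hvu
    fun huv => hv (hu.mem_of_isParent v huv)

end LeafPruning

section ReadingEdges

namespace RealRAM

/-- The instructions that replace the vertex in register `d` by the address of its record. -/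
def toAddress (d : ℕ) : List Instr := [.iadd d d d, .iadd d d d, .iadd d d 4]

/-- The instructions that add the address in register `b` to the record at the address in
register `a`. -/
def attach (a b : ℕ) : List Instr :=
  [.iload 11 a, .iadd 11 11 1, .istore a 11,
    .iadd 12 a 1, .iload 11 12, .iadd 11 11 b, .istore 12 11]

/-- The preparation of the registers. The natural registers are used as follows: 0 to 4 hold the
constants 0, 1, 2, 4, 16; 5 a loop bound; 6 the position in a loop or the base of the stack; 7 a
pointer into the input, the stack or the output; 8 and 9 the addresses of the current vertex and of
its neighbour; 10 to 12 temporary values. The vertex `v` has its record in the cells `4 * v + 16`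
and `4 * v + 17`, and the stack has its entries in the cells `18`, `22`, and so on. -/
def prepare : List Instr :=
  [.iconst 1 1, .iconst 2 2, .iconst 3 4, .iconst 4 16, .input 5 1, .iconst 7 3]

/-- The input of an edge and of its mark. -/
def loadEdge : List Instr :=
  [.input 8 7, .iadd 7 7 1, .input 9 7, .iadd 7 7 1, .input 10 7, .iadd 7 7 1, .iadd 6 6 1] ++
    toAddress 8 ++ toAddress 9

/-- The processing of the next edge in the input. -/
def readEdge : Code :=
  .seq (.block loadEdge)
    (.ifLE 10 0 (.block []) (.seq (.block (attach 8 9)) (.block (attach 9 8))))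

end RealRAM

variable {n m : ℕ}

theorem encodeInstance_fst {ends : Fin m → Fin n × Fin n} {mark : Fin m → Bool} {root : Fin n}
    (j : Fin m) : encodeInstance ends mark root (3 * j + 3) = (ends j).1 := by
  simp [encodeInstance]

theorem encodeInstance_snd {ends : Fin m → Fin n × Fin n} {mark : Fin m → Bool} {root : Fin n}
    (j : Fin m) : encodeInstance ends mark root (3 * j + 4) = (ends j).2 := by
  have hdiv : (3 * (j : ℕ) + 1) / 3 = j := by omega
  have hmod : (3 * (j : ℕ) + 1) % 3 = 1 := by omega
  simp [encodeInstance, hdiv, hmod]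

theorem encodeInstance_mark {ends : Fin m → Fin n × Fin n} {mark : Fin m → Bool} {root : Fin n}
    (j : Fin m) : encodeInstance ends mark root (3 * j + 5) = (mark j).toNat := by
  have hdiv : (3 * (j : ℕ) + 2) / 3 = j := by omega
  have hmod : (3 * (j : ℕ) + 2) % 3 = 2 := by omega
  simp [encodeInstance, hdiv, hmod]

/-- The neighbours of `v` along the first `j` edges, of which only the marked ones count. -/
def markedNeighbors (ends : Fin m → Fin n × Fin n) (mark : Fin m → Bool) (j : ℕ) (v : Fin n) :
    Finset (Fin n) :=
  {w | ∃ i : Fin m, i < j ∧ mark i = true ∧ s((ends i).1, (ends i).2) = s(v, w)}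

variable {G S : SimpleGraph (Fin n)} {ends : Fin m → Fin n × Fin n} {mark : Fin m → Bool}
  {v w : Fin n}

theorem mem_markedNeighbors {j : ℕ} : w ∈ markedNeighbors ends mark j v ↔
    ∃ i : Fin m, i < j ∧ mark i = true ∧ s((ends i).1, (ends i).2) = s(v, w) := by
  simp only [markedNeighbors, Finset.mem_filter, Finset.mem_univ, true_and]

theorem mem_markedNeighbors_succ {j : Fin m} : w ∈ markedNeighbors ends mark (j + 1) v ↔
    w ∈ markedNeighbors ends mark j v ∨ mark j = true ∧ s((ends j).1, (ends j).2) = s(v, w) := by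
  simp only [mem_markedNeighbors, Nat.lt_succ_iff_lt_or_eq, Fin.val_inj, or_and_right, exists_or,
    exists_eq_left]

theorem markedNeighbors_succ_of_mark_eq_false {j : Fin m} (hj : mark j = false) :
    markedNeighbors ends mark (j + 1) = markedNeighbors ends mark j := by
  ext v w
  simp [mem_markedNeighbors_succ, hj]

theorem markedNeighbors_succ_of_notMem {j : Fin m} (hv : v ∉ s((ends j).1, (ends j).2)) :
    markedNeighbors ends mark (j + 1) v = markedNeighbors ends mark j v := by
  ext w
  rw [mem_markedNeighbors_succ, or_iff_left]
  exact fun h => hv (h.2 ▸ Sym2.mem_mk_left v w)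

theorem markedNeighbors_succ_of_eq {j : Fin m} (hj : mark j = true)
    (he : s((ends j).1, (ends j).2) = s(v, w)) :
    markedNeighbors ends mark (j + 1) v = insert w (markedNeighbors ends mark j v) := by
  ext u
  rw [mem_markedNeighbors_succ, Finset.mem_insert, he, Sym2.congr_right, and_iff_right hj,
    or_comm, eq_comm]

theorem IsEdgeList.notMem_markedNeighbors (h : IsEdgeList G S ends mark) {j : Fin m}
    (he : s((ends j).1, (ends j).2) = s(v, w)) : w ∉ markedNeighbors ends mark j v := by
  rw [mem_markedNeighbors]
  rintro ⟨i, hij, -, hi⟩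
  exact hij.ne (congrArg Fin.val (h.injective (hi.trans he.symm)))

theorem IsEdgeList.fst_ne_snd (h : IsEdgeList G S ends mark) (j : Fin m) :
    (ends j).1 ≠ (ends j).2 := by
  have hj : s((ends j).1, (ends j).2) ∈ G.edgeSet := h.range_eq ▸ Set.mem_range_self j
  exact hj.ne

theorem IsEdgeList.markedNeighbors_eq (h : IsEdgeList G S ends mark) (hle : S ≤ G) :
    markedNeighbors ends mark m = neighborsOutside S [] := by
  ext v w
  rw [mem_markedNeighbors, mem_neighborsOutside, and_iff_left List.not_mem_nil]
  constructor
  · rintro ⟨i, -, hi, he⟩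
    rwa [h.mark_iff, ← SimpleGraph.mem_edgeSet, he, SimpleGraph.mem_edgeSet] at hi
  · intro hvw
    obtain ⟨i, hi : s((ends i).1, (ends i).2) = s(v, w)⟩ :
        s(v, w) ∈ Set.range fun j => s((ends j).1, (ends j).2) :=
      h.range_eq ▸ hle hvw
    refine ⟨i, i.2, ?_, hi⟩
    rwa [h.mark_iff, ← SimpleGraph.mem_edgeSet, hi, SimpleGraph.mem_edgeSet]

open RealRAM

/-- The record of every vertex `v` consists of the number of the vertices in `N v` and the sum of
their addresses. -/
def StoresRecords (I : ℕ → ℕ) (N : Fin n → Finset (Fin n)) : Prop :=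
  ∀ v : Fin n, I (4 * v + 16) = (N v).card ∧ I (4 * v + 17) = ∑ w ∈ N v, (4 * w + 16 : ℕ)

/-- The registers that hold constants. -/
structure HasConstants (I : ℕ → ℕ) : Prop where
  zero : I 0 = 0
  one : I 1 = 1
  two : I 2 = 2
  four : I 3 = 4
  sixteen : I 4 = 16

theorem HasConstants.congr {I I' : ℕ → ℕ} (h : HasConstants I) (hI : ∀ k < 5, I' k = I k) :
    HasConstants I' where
  zero := by rw [hI _ (by norm_num), h.zero]
  one := by rw [hI _ (by norm_num), h.one]
  two := by rw [hI _ (by norm_num), h.two]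
  four := by rw [hI _ (by norm_num), h.four]
  sixteen := by rw [hI _ (by norm_num), h.sixteen]

/-- The memory while the edges are read: `j` of the `m` edges have been taken from the input, and
the records are those of the sets `N v`. -/
structure ReadInv (m j : ℕ) (N : Fin n → Finset (Fin n)) (s : Mem) : Prop
    extends HasConstants s.I where
  le : j ≤ m
  bound : s.I 5 = m
  counter : s.I 6 = j
  pointer : s.I 7 = 3 * j + 3
  records : StoresRecords s.I N

theorem prepare_achieves (root : Fin n) :
    (Code.block prepare).Achieves (encodeInstance ends mark root)
      ⟨fun _ => 0, fun _ => 0, fun _ => 0⟩ 6 (ReadInv m 0 (markedNeighbors ends mark 0)) := by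
  refine .block rfl ?_
  simp only [prepare, List.foldlM, stepMem, exec, Mem.toConfig, Option.map_some, Option.pure_def,
    Option.bind_eq_bind, Option.bind_some, Option.some.injEq, exists_eq_left']
  constructor
  case le => exact m.zero_le
  case toHasConstants =>
    constructor <;> simp (disch := omega) only [Function.update_self, Function.update_of_ne]
  case records => exact fun v => by simp (disch := omega) [markedNeighbors]
  all_goals simp (disch := omega) only [Function.update_self, Function.update_of_ne]
  rfl

theorem loadEdge_achieves {root : Fin n} {N : Fin n → Finset (Fin n)} {j : Fin m} {s : Mem}
    (h : ReadInv m j N s) :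
    (Code.block loadEdge).Achieves (encodeInstance ends mark root) s 13 fun s' =>
      ReadInv m (j + 1) N s' ∧ s'.I 8 = 4 * (ends j).1 + 16 ∧ s'.I 9 = 4 * (ends j).2 + 16 ∧
        s'.I 10 = (mark j).toNat := by
  refine .block rfl ?_
  simp (disch := omega) only [loadEdge, toAddress, List.cons_append, List.nil_append, List.foldlM,
    stepMem, exec, Mem.toConfig, Option.map_some, Option.pure_def, Option.bind_eq_bind,
    Option.bind_some, Option.some.injEq, exists_eq_left', Function.update_self,
    Function.update_of_ne, h.pointer, h.counter, h.one, h.sixteen, encodeInstance_fst,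
    encodeInstance_snd, encodeInstance_mark]
  refine ⟨?_, by ring, by ring, trivial⟩
  constructor
  case le => exact j.2
  case toHasConstants =>
    exact h.toHasConstants.congr fun k hk => by simp (disch := omega) only [Function.update_of_ne]
  case records =>
    intro v
    simp (disch := omega) only [Function.update_of_ne]
    exact h.records v
  all_goals simp (disch := omega) only [Function.update_self, Function.update_of_ne, h.bound]
  ring

theorem attach_achieves {x : ℕ → ℕ} {s : Mem} {a b : ℕ} (h1 : s.I 1 = 1) (ha : a < 11) (hb : b < 11)
    (hsa : 13 ≤ s.I a) :
    (Code.block (attach a b)).Achieves x s 7 fun s' =>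
      s'.I (s.I a) = s.I (s.I a) + 1 ∧ s'.I (s.I a + 1) = s.I (s.I a + 1) + s.I b ∧
      ∀ k, k ≠ 11 ∧ k ≠ 12 ∧ k ≠ s.I a ∧ k ≠ s.I a + 1 → s'.I k = s.I k := by
  refine .block rfl ?_
  simp (disch := omega) only [attach, List.foldlM, stepMem, exec, Mem.toConfig,
    Option.map_some, Option.pure_def, Option.bind_eq_bind, Option.bind_some, Option.some.injEq,
    exists_eq_left', Function.update_self, Function.update_of_ne, h1]
  refine ⟨trivial, trivial, fun k hk => ?_⟩
  simp (disch := omega) only [Function.update_of_ne]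

theorem StoresRecords.markedNeighbors_succ {I I' : ℕ → ℕ} {j : Fin m}
    (hE : IsEdgeList G S ends mark)
    (hj : mark j = true) (h : StoresRecords I (markedNeighbors ends mark j))
    (hnew : ∀ v w : Fin n, s((ends j).1, (ends j).2) = s(v, w) →
      I' (4 * v + 16) = I (4 * v + 16) + 1 ∧ I' (4 * v + 17) = I (4 * v + 17) + (4 * w + 16))
    (hold : ∀ v : Fin n, v ∉ s((ends j).1, (ends j).2) →
      I' (4 * v + 16) = I (4 * v + 16) ∧ I' (4 * v + 17) = I (4 * v + 17)) :
    StoresRecords I' (markedNeighbors ends mark (j + 1)) := by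
  intro v
  by_cases hv : v ∈ s((ends j).1, (ends j).2)
  · obtain ⟨w, he⟩ := hv
    have hw := hE.notMem_markedNeighbors he
    rw [markedNeighbors_succ_of_eq hj he, Finset.card_insert_of_notMem hw,
      Finset.sum_insert hw, (hnew v w he).1, (hnew v w he).2, (h v).1, (h v).2]
    exact ⟨rfl, add_comm _ _⟩
  · rw [markedNeighbors_succ_of_notMem hv, (hold v hv).1, (hold v hv).2]
    exact h v

theorem recordEdge_achieves {x : ℕ → ℕ} {j : Fin m} {s : Mem} (hE : IsEdgeList G S ends mark)
    (h : ReadInv m (j + 1) (markedNeighbors ends mark j) s) (hj : mark j = true)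
    (h8 : s.I 8 = 4 * (ends j).1 + 16) (h9 : s.I 9 = 4 * (ends j).2 + 16) :
    (Code.seq (.block (attach 8 9)) (.block (attach 9 8))).Achieves x s (7 + 7)
      (ReadInv m (j + 1) (markedNeighbors ends mark (j + 1))) := by
  have hne := Fin.val_ne_of_ne (hE.fst_ne_snd j)
  refine .seq (attach_achieves (a := 8) (b := 9) h.one (by omega) (by omega) (by omega))
    fun s₁ hs₁ => ?_
  rw [h8, h9] at hs₁
  obtain ⟨hcard₁, hsum₁, hs₁⟩ := hs₁
  have h8₁ : s₁.I 8 = s.I 8 := hs₁ _ (by omega)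
  have h9₁ : s₁.I 9 = s.I 9 := hs₁ _ (by omega)
  have h1₁ : s₁.I 1 = 1 := (hs₁ _ (by omega)).trans h.one
  refine .imp (attach_achieves (a := 9) (b := 8) h1₁ (by omega) (by omega) (by omega))
    fun s₂ hs₂ => ?_
  rw [h8₁, h9₁, h8, h9] at hs₂
  obtain ⟨hcard₂, hsum₂, hs₂⟩ := hs₂
  have hs (k : ℕ) (hk : k < 11 ∨ 16 ≤ k ∧ k ≠ 4 * (ends j).1 + 16 ∧ k ≠ 4 * (ends j).1 + 17 ∧
      k ≠ 4 * (ends j).2 + 16 ∧ k ≠ 4 * (ends j).2 + 17) : s₂.I k = s.I k := by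
    rw [hs₂ k (by omega), hs₁ k (by omega)]
  constructor
  case toHasConstants => exact h.toHasConstants.congr fun k hk => hs k (by omega)
  case le => exact h.le
  case records =>
    refine h.records.markedNeighbors_succ hE hj (fun v w he => ?_) fun v hv => ?_
    · rcases Sym2.eq_iff.1 he with ⟨rfl, rfl⟩ | ⟨rfl, rfl⟩
      · rw [hs₂ _ (by omega), hs₂ _ (by omega)]
        exact ⟨hcard₁, hsum₁⟩
      · rw [hcard₂, hsum₂, hs₁ _ (by omega), hs₁ _ (by omega)]
        exact ⟨rfl, rfl⟩
    · rw [Sym2.mem_iff, not_or, Fin.ext_iff, Fin.ext_iff] at hv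
      constructor <;> apply hs <;> omega
  all_goals rw [hs _ (by omega)]
  · exact h.bound
  · exact h.counter
  · exact h.pointer

theorem readEdge_achieves {root : Fin n} {j : Fin m} {s : Mem} (hE : IsEdgeList G S ends mark)
    (h : ReadInv m j (markedNeighbors ends mark j) s) :
    readEdge.Achieves (encodeInstance ends mark root) s (13 + (7 + 7 + 2))
      (ReadInv m (j + 1) (markedNeighbors ends mark (j + 1))) := by
  refine .seq (loadEdge_achieves (ends := ends) (mark := mark) h) fun s' ⟨h', h8, h9, h10⟩ =>
    .ifLE (fun hle => ?_) fun hle => ?_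
  · have hj : mark j = false := by simpa [h10, h'.zero] using hle
    rw [markedNeighbors_succ_of_mark_eq_false hj]
    exact .mono (.block rfl ⟨s', rfl, h'⟩) (Nat.zero_le _)
  · have hj : mark j = true := by simpa [h10, h'.zero] using hle
    exact recordEdge_achieves hE h' hj h8 h9

theorem readEdges_achieves {root : Fin n} {s : Mem} (hE : IsEdgeList G S ends mark)
    (h : ReadInv m 0 (markedNeighbors ends mark 0) s) :
    (Code.untilLE 5 6 readEdge).Achieves (encodeInstance ends mark root) s (m * 31 + 1)
      (ReadInv m m (markedNeighbors ends mark m)) := by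
  refine .imp (.untilLE (ι := ℕ) (Inv := fun j => ReadInv m j (markedNeighbors ends mark j))
    (φ := fun j => m - j) (fun j s h hj => ?_) h) fun s' ⟨j, h, hj⟩ => ?_
  · rw [h.bound, h.counter] at hj
    exact .imp (readEdge_achieves (j := ⟨j, by omega⟩) hE h) fun s' h' =>
      ⟨j + 1, by omega, h'⟩
  · rw [h.bound, h.counter] at hj
    obtain rfl := h.le.antisymm hj
    exact h

end ReadingEdges

section Pruning

namespace RealRAM

/-- The preparation of the pruning: the degree of the root is increased by 2, which keeps the root
from being removed, and the scan of the vertices starts. -/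
def startPruning : List Instr :=
  [.input 8 2] ++ toAddress 8 ++ [.iload 11 8, .iadd 11 11 2, .istore 8 11, .input 5 0] ++
    toAddress 5 ++ [.iconst 6 16, .iconst 8 16, .iconst 7 18]

/-- The instructions that remove the address in register `b` from the record at the address in
register `a`. -/
def detach (a b : ℕ) : List Instr :=
  [.iload 11 a, .isub 11 11 1, .istore a 11,
    .iadd 12 a 1, .iload 11 12, .isub 11 11 b, .istore 12 11]

/-- The removal of the current vertex, which is a leaf: it is pushed to the stack, its degree
becomes 2, and its parent becomes the current vertex. -/
def popLeaf : List Instr :=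
  [.istore 7 8, .iadd 7 7 3, .istore 8 2, .iadd 9 8 0, .iadd 12 8 1, .iload 8 12]

/-- The instructions that proceed to the next vertex of the scan. -/
def nextVertex : List Instr := [.iadd 6 6 3, .iadd 8 6 0]

/-- The current vertex is removed if its remaining degree is less than 2; otherwise the scan
proceeds to the next vertex. -/
def pruneStep : Code :=
  .seq (.block [.iload 11 8])
    (.ifLE 2 11 (.block nextVertex) (.seq (.block popLeaf) (.block (detach 8 9))))

end RealRAM

open RealRAM

variable {n m : ℕ} {S : SimpleGraph (Fin n)} {root : Fin n}

/-- The records after the removal of the vertices in `W`: a remaining vertex has its remaining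
degree, increased by 2 for the root, and the sum of the addresses of its remaining neighbours,
whereas a removed vertex has the address of its parent. -/
structure StoresPrunedRecords (S : SimpleGraph (Fin n)) (root : Fin n) (W : List (Fin n))
    (I : ℕ → ℕ) : Prop where
  card : ∀ v, v ∉ W →
    I (4 * v + 16) = (neighborsOutside S W v).card + if v = root then 2 else 0
  sum : ∀ v, v ∉ W → I (4 * v + 17) = ∑ w ∈ neighborsOutside S W v, (4 * w + 16 : ℕ)
  removed : ∀ v ∈ W, I (4 * v + 16) = 2
  parent : ∀ p, ∀ v ∈ W, IsParent S root p v → I (4 * v + 17) = 4 * p + 16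

theorem StoresPrunedRecords.lt_two_iff {W : List (Fin n)} {I : ℕ → ℕ} (hS : S.IsTree)
    (hW : IsPruning S root W) (h : StoresPrunedRecords S root W I) (v : Fin n) :
    I (4 * v + 16) < 2 ↔ IsPrunable S root W v := by
  constructor
  · intro hlt
    have hvW : v ∉ W := fun hvW => hlt.ne (h.removed v hvW)
    rw [h.card v hvW] at hlt
    have hv : v ≠ root := by
      rintro rfl
      simp at hlt
    rw [if_neg hv] at hlt
    exact hW.isPrunable_of_card_lt_two hS.connected hv hvW hlt
  · intro hv
    obtain ⟨p, hp⟩ := exists_isParent hS.connected hv.ne_root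
    rw [h.card v hv.notMem, hv.neighborsOutside_eq hS hW hp, if_neg hv.ne_root,
      Finset.card_singleton]
    norm_num

theorem StoresPrunedRecords.congr {W : List (Fin n)} {I I' : ℕ → ℕ}
    (h : StoresPrunedRecords S root W I) (hI : ∀ k ≥ 16, I' k = I k) :
    StoresPrunedRecords S root W I' where
  card v hv := by rw [hI _ (by omega), h.card v hv]
  sum v hv := by rw [hI _ (by omega), h.sum v hv]
  removed v hv := by rw [hI _ (by omega), h.removed v hv]
  parent p v hv hp := by rw [hI _ (by omega), h.parent p v hv hp]

/-- The memory cells `18, 22, 26, …` hold the addresses of the vertices in `W`, in the order of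
their removal. -/
def StoresStack (I : ℕ → ℕ) (W : List (Fin n)) : Prop :=
  ∀ u W', u :: W' <:+ W → I (4 * W'.length + 18) = 4 * u + 16

theorem StoresStack.congr {W : List (Fin n)} {I I' : ℕ → ℕ} (h : StoresStack I W)
    (hI : ∀ k ≥ 16, I' k = I k) : StoresStack I' W := fun u W' hW' => by
  rw [hI _ (by omega), h u W' hW']

theorem StoresPrunedRecords.cons {W : List (Fin n)} {I I' : ℕ → ℕ} {p u : Fin n} (hS : S.IsTree)
    (hW : IsPruning S root W) (hu : IsPrunable S root W u) (hp : IsParent S root p u)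
    (h : StoresPrunedRecords S root W I) (hu_card : I' (4 * u + 16) = 2)
    (hu_sum : I' (4 * u + 17) = I (4 * u + 17)) (hp_card : I' (4 * p + 16) = I (4 * p + 16) - 1)
    (hp_sum : I' (4 * p + 17) = I (4 * p + 17) - (4 * u + 16))
    (hI' : ∀ v, v ≠ u → v ≠ p →
      I' (4 * v + 16) = I (4 * v + 16) ∧ I' (4 * v + 17) = I (4 * v + 17)) :
    StoresPrunedRecords S root (u :: W) I' := by
  have hpW := hu.parent_notMem hW hp
  have hpW' := List.not_mem_of_not_mem_cons hpW
  have hu_mem : u ∈ neighborsOutside S W p := mem_neighborsOutside.2 ⟨hp.1, hu.notMem⟩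
  have hother (v : Fin n) (hv : v ∉ u :: W) (hvp : v ≠ p) :
      neighborsOutside S (u :: W) v = neighborsOutside S W v := by
    rw [neighborsOutside_cons, Finset.erase_eq_of_notMem]
    exact hu.notMem_neighborsOutside hS (List.not_mem_of_not_mem_cons hv) fun h => hvp (h.eq hS hp)
  constructor
  case card =>
    intro v hv
    obtain rfl | hvp := eq_or_ne v p
    · rw [hp_card, h.card v hpW', neighborsOutside_cons, Finset.card_erase_of_mem hu_mem]
      have := Finset.card_pos.2 ⟨u, hu_mem⟩
      omega
    · rw [hother v hv hvp, (hI' v (List.ne_of_not_mem_cons hv) hvp).1,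
        h.card v (List.not_mem_of_not_mem_cons hv)]
  case sum =>
    intro v hv
    obtain rfl | hvp := eq_or_ne v p
    · rw [hp_sum, h.sum v hpW', neighborsOutside_cons, ← Finset.sum_erase_add _ _ hu_mem,
        Nat.add_sub_cancel]
    · rw [hother v hv hvp, (hI' v (List.ne_of_not_mem_cons hv) hvp).2,
        h.sum v (List.not_mem_of_not_mem_cons hv)]
  case removed =>
    intro v hv
    obtain rfl | hvu := eq_or_ne v u
    · exact hu_card
    · have hvW := List.mem_of_ne_of_mem hvu hv
      rw [(hI' v hvu fun h => hpW' (h ▸ hvW)).1, h.removed v hvW]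
  case parent =>
    intro q v hv hq
    obtain rfl | hvu := eq_or_ne v u
    · rw [hu_sum, h.sum v hu.notMem, hu.neighborsOutside_eq hS hW hq, Finset.sum_singleton]
    · have hvW := List.mem_of_ne_of_mem hvu hv
      rw [(hI' v hvu fun h => hpW' (h ▸ hvW)).2, h.parent q v hvW hq]

theorem StoresStack.cons {W : List (Fin n)} {I I' : ℕ → ℕ} {u : Fin n} (h : StoresStack I W)
    (hu : I' (4 * W.length + 18) = 4 * u + 16)
    (hI' : ∀ i < W.length, I' (4 * i + 18) = I (4 * i + 18)) : StoresStack I' (u :: W) := by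
  intro v W' hW'
  rcases List.suffix_cons_iff.1 hW' with heq | hW'
  · obtain ⟨rfl, rfl⟩ := List.cons.inj heq
    exact hu
  · rw [hI' _ hW'.length_le, h v W' hW']

theorem detach_achieves {x : ℕ → ℕ} {s : Mem} {a b : ℕ} (h1 : s.I 1 = 1) (ha : a < 11)
    (hb : b < 11) (hsa : 13 ≤ s.I a) :
    (Code.block (detach a b)).Achieves x s 7 fun s' =>
      s'.I (s.I a) = s.I (s.I a) - 1 ∧ s'.I (s.I a + 1) = s.I (s.I a + 1) - s.I b ∧
      ∀ k, k ≠ 11 ∧ k ≠ 12 ∧ k ≠ s.I a ∧ k ≠ s.I a + 1 → s'.I k = s.I k := by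
  refine .block rfl ?_
  simp (disch := omega) only [detach, List.foldlM, stepMem, exec, Mem.toConfig,
    Option.map_some, Option.pure_def, Option.bind_eq_bind, Option.bind_some, Option.some.injEq,
    exists_eq_left', Function.update_self, Function.update_of_ne, h1]
  refine ⟨trivial, trivial, fun k hk => ?_⟩
  simp (disch := omega) only [Function.update_of_ne]

theorem popLeaf_achieves {x : ℕ → ℕ} {s : Mem} (h : HasConstants s.I) {k a : ℕ}
    (hk : s.I 7 = k) (ha : s.I 8 = a) (hk16 : 16 ≤ k) (ha16 : 16 ≤ a) (hka : k ≠ a)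
    (hka' : k ≠ a + 1) :
    (Code.block popLeaf).Achieves x s 6 fun s' =>
      s'.I 7 = k + 4 ∧ s'.I 8 = s.I (a + 1) ∧ s'.I 9 = a ∧ s'.I k = a ∧ s'.I a = 2 ∧
      ∀ j, j < 7 ∨ 16 ≤ j ∧ j ≠ k ∧ j ≠ a → s'.I j = s.I j := by
  refine .block rfl ?_
  simp (disch := omega) only [popLeaf, List.foldlM, stepMem, exec, Mem.toConfig,
    Option.map_some, Option.pure_def, Option.bind_eq_bind, Option.bind_some, Option.some.injEq,
    exists_eq_left', Function.update_self, Function.update_of_ne, h.zero, h.one, h.two, h.four, hk,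
    ha]
  refine ⟨trivial, trivial, by ring, trivial, trivial, fun j hj => ?_⟩
  simp (disch := omega) only [Function.update_of_ne]

theorem removeLeaf_achieves {x : ℕ → ℕ} {s : Mem} (h : HasConstants s.I) {k a b : ℕ}
    (hk : s.I 7 = k) (ha : s.I 8 = a) (hb : s.I (a + 1) = b) (hk16 : 16 ≤ k) (ha16 : 16 ≤ a)
    (hb16 : 16 ≤ b) (hka : k ≠ a) (hka' : k ≠ a + 1) (hkb : k ≠ b) (hkb' : k ≠ b + 1)
    (hab : a ≠ b) (hab' : a ≠ b + 1) :
    (Code.seq (.block popLeaf) (.block (detach 8 9))).Achieves x s (6 + 7) fun s' =>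
      s'.I 7 = k + 4 ∧ s'.I 8 = b ∧ s'.I k = a ∧ s'.I a = 2 ∧ s'.I b = s.I b - 1 ∧
      s'.I (b + 1) = s.I (b + 1) - a ∧
      ∀ j, j < 7 ∨ 16 ≤ j ∧ j ≠ k ∧ j ≠ a ∧ j ≠ b ∧ j ≠ b + 1 → s'.I j = s.I j := by
  refine .seq (popLeaf_achieves h hk ha hk16 ha16 hka hka')
    fun s₁ ⟨h7₁, h8₁, h9₁, hk₁, ha₁, hs₁⟩ => ?_
  rw [hb] at h8₁
  have h1₁ : s₁.I 1 = 1 := (hs₁ 1 (by omega)).trans h.one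
  refine .imp (detach_achieves (a := 8) (b := 9) h1₁ (by omega) (by omega) (by omega))
    fun s₂ hs₂ => ?_
  rw [h8₁, h9₁, hs₁ b (by omega), hs₁ (b + 1) (by omega)] at hs₂
  obtain ⟨hb₂, hb₂', hs₂⟩ := hs₂
  refine ⟨?_, ?_, ?_, ?_, hb₂, hb₂', fun j hj => ?_⟩ <;> rw [hs₂ _ (by omega)]
  exacts [h7₁, h8₁, hk₁, ha₁, hs₁ j (by omega)]

/-- The memory during the pruning: the vertices in `W` have been removed, the scan has reached the
vertex `c`, and the current vertex is `u`. Whatever could be removed among the vertices up to `c`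
is the current vertex. The scan is over once `c = u = n`. -/
structure PruneInv (S : SimpleGraph (Fin n)) (root : Fin n) (W : List (Fin n)) (c u : ℕ) (s : Mem) :
    Prop extends HasConstants s.I where
  pruning : IsPruning S root W
  records : StoresPrunedRecords S root W s.I
  stack : StoresStack s.I W
  bound : s.I 5 = 4 * n + 16
  scan : s.I 6 = 4 * c + 16
  current : s.I 8 = 4 * u + 16
  pointer : s.I 7 = 4 * W.length + 18
  le : c ≤ n
  lt_iff : u < n ↔ c < n
  eq_of_isPrunable : ∀ v : Fin n, IsPrunable S root W v → v ≤ c → v = u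

theorem startPruning_achieves {ends : Fin m → Fin n × Fin n} {mark : Fin m → Bool} {s : Mem}
    (h : ReadInv m m (neighborsOutside S []) s) :
    (Code.block startPruning).Achieves (encodeInstance ends mark root) s 14
      (PruneInv S root [] 0 0) := by
  refine .block rfl ?_
  simp (disch := omega) only [startPruning, toAddress, List.cons_append, List.nil_append,
    List.foldlM, stepMem, exec, Mem.toConfig, Option.map_some, Option.pure_def,
    Option.bind_eq_bind, Option.bind_some, Option.some.injEq, exists_eq_left',
    Function.update_self, Function.update_of_ne, h.zero, h.two, h.sixteen, encodeInstance]
  constructor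
  case toHasConstants =>
    exact h.toHasConstants.congr fun k hk => by simp (disch := omega) only [Function.update_of_ne]
  case pruning => exact .nil
  case records =>
    constructor
    case card =>
      intro v _
      obtain rfl | hne := eq_or_ne v root
      · have haddr : 4 * (v : ℕ) + 16 = v + v + (v + v) + 16 := by ring
        rw [haddr]
        simp (disch := omega) only [Function.update_self, Function.update_of_ne]
        rw [← haddr, (h.records v).1, if_true]
      · have hne' := Fin.val_ne_of_ne hne
        simp (disch := omega) only [Function.update_of_ne]
        rw [(h.records v).1, if_neg hne, add_zero]
    case sum =>
      intro v _
      simp (disch := omega) only [Function.update_of_ne]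
      exact (h.records v).2
    all_goals simp only [List.not_mem_nil, false_imp_iff, implies_true]
  case stack => exact fun u W' h => absurd h.length_le (by simp)
  case le => exact n.zero_le
  case lt_iff => exact Iff.rfl
  case eq_of_isPrunable => exact fun v _ hv => Nat.le_zero.1 hv
  all_goals simp (disch := omega) only [Function.update_self, Function.update_of_ne]
  exacts [by ring, rfl]

theorem loadDegree_achieves {x : ℕ → ℕ} {W : List (Fin n)} {c u : ℕ} {s : Mem}
    (h : PruneInv S root W c u s) :
    (Code.block [.iload 11 8]).Achieves x s 1 fun s' =>
      PruneInv S root W c u s' ∧ s'.I 11 = s'.I (4 * u + 16) := by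
  refine .block rfl ?_
  simp (disch := omega) only [List.foldlM, stepMem, exec, Mem.toConfig, Option.map_some,
    Option.pure_def, Option.bind_eq_bind, Option.bind_some, Option.some.injEq, exists_eq_left',
    Function.update_self, Function.update_of_ne, h.current]
  refine ⟨?_, trivial⟩
  constructor
  case toHasConstants =>
    exact h.toHasConstants.congr fun k hk => by simp (disch := omega) only [Function.update_of_ne]
  case pruning => exact h.pruning
  case records =>
    exact h.records.congr fun k hk => by simp (disch := omega) only [Function.update_of_ne]
  case stack =>
    exact h.stack.congr fun k hk => by simp (disch := omega) only [Function.update_of_ne]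
  case le => exact h.le
  case lt_iff => exact h.lt_iff
  case eq_of_isPrunable => exact h.eq_of_isPrunable
  all_goals simp (disch := omega) only [Function.update_of_ne]
  exacts [h.bound, h.scan, h.current, h.pointer]

theorem nextVertex_achieves {x : ℕ → ℕ} {W : List (Fin n)} {c u : ℕ} {s : Mem} (hS : S.IsTree)
    (h : PruneInv S root W c u s) (hc : c < n) (hu : 2 ≤ s.I (4 * u + 16)) :
    (Code.block nextVertex).Achieves x s 2 (PruneInv S root W (c + 1) (c + 1)) := by
  refine .block rfl ?_
  simp (disch := omega) only [nextVertex, List.foldlM, stepMem, exec, Mem.toConfig, Option.map_some,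
    Option.pure_def, Option.bind_eq_bind, Option.bind_some, Option.some.injEq, exists_eq_left',
    Function.update_self, Function.update_of_ne, h.zero, h.four, h.scan]
  constructor
  case toHasConstants =>
    exact h.toHasConstants.congr fun k hk => by simp (disch := omega) only [Function.update_of_ne]
  case pruning => exact h.pruning
  case records =>
    exact h.records.congr fun k hk => by simp (disch := omega) only [Function.update_of_ne]
  case stack =>
    exact h.stack.congr fun k hk => by simp (disch := omega) only [Function.update_of_ne]
  case le => exact hc
  case lt_iff => exact Iff.rfl
  case eq_of_isPrunable =>
    refine fun v hv hvc => hvc.antisymm (Nat.succ_le_of_lt (not_le.1 fun hle => ?_))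
    have hlt := (h.records.lt_two_iff hS h.pruning v).2 hv
    rw [h.eq_of_isPrunable v hv hle] at hlt
    exact hlt.not_ge hu
  all_goals simp (disch := omega) only [Function.update_self, Function.update_of_ne]
  exacts [h.bound, by ring, by ring, h.pointer]

theorem pruneLeaf_achieves {x : ℕ → ℕ} {W : List (Fin n)} {c : ℕ} {u : Fin n} {s : Mem}
    (hS : S.IsTree) (h : PruneInv S root W c u s) (hu : IsPrunable S root W u) :
    ∃ p : Fin n, (Code.seq (.block popLeaf) (.block (detach 8 9))).Achieves x s (6 + 7)
      (PruneInv S root (u :: W) c p) := by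
  obtain ⟨p, hp⟩ := exists_isParent hS.connected hu.ne_root
  have hup := Fin.val_ne_of_ne hp.1.ne'
  have hp_addr : s.I (4 * u + 16 + 1) = 4 * p + 16 := by
    rw [h.records.sum u hu.notMem, hu.neighborsOutside_eq hS h.pruning hp, Finset.sum_singleton]
  refine ⟨p, .imp (removeLeaf_achieves h.toHasConstants h.pointer h.current hp_addr
    (by omega) (by omega) (by omega) (by omega) (by omega) (by omega) (by omega) (by omega)
    (by omega)) fun s' ⟨h7, h8, hk, ha, hb, hb', hs⟩ => ?_⟩
  constructor
  case toHasConstants => exact h.toHasConstants.congr fun k hk => hs k (by omega)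
  case pruning => exact h.pruning.cons hu
  case records =>
    refine h.records.cons hS h.pruning hu hp ha (hs _ (by omega)) hb hb' fun v hvu hvp => ?_
    have hvu := Fin.val_ne_of_ne hvu
    have hvp := Fin.val_ne_of_ne hvp
    exact ⟨hs _ (by omega), hs _ (by omega)⟩
  case stack => exact h.stack.cons hk fun i hi => hs _ (by omega)
  case bound => rw [hs _ (by omega), h.bound]
  case scan => rw [hs _ (by omega), h.scan]
  case current => exact h8
  case pointer => rw [h7, List.length_cons]; ring
  case le => exact h.le
  case lt_iff => exact iff_of_true p.2 (h.lt_iff.1 u.2)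
  case eq_of_isPrunable =>
    refine fun v hv hvc => by_contra fun hvp => ?_
    have hvW := hv.of_cons fun hv' => hvp (congrArg _ (hv'.eq hS hp))
    exact hv.notMem (Fin.ext (h.eq_of_isPrunable v hvW hvc) ▸ List.mem_cons_self)

theorem pruneStep_achieves {x : ℕ → ℕ} {W : List (Fin n)} {c u : ℕ} {s : Mem} (hS : S.IsTree)
    (h : PruneInv S root W c u s) (hc : c < n) :
    pruneStep.Achieves x s (1 + (13 + 2)) fun s' =>
      PruneInv S root W (c + 1) (c + 1) s' ∨
        ∃ v p : Fin n, PruneInv S root (v :: W) c p s' := by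
  refine .seq (loadDegree_achieves h) fun s₁ ⟨h₁, h11⟩ => .ifLE (fun hle => ?_) fun hle => ?_
  · rw [h₁.two, h11] at hle
    exact .mono (.imp (nextVertex_achieves hS h₁ hc hle) fun _ => .inl) (by norm_num)
  · rw [h₁.two, h11, not_le] at hle
    lift u to Fin n using h.lt_iff.2 hc
    obtain ⟨p, hp⟩ :=
      pruneLeaf_achieves (x := x) hS h₁ ((h₁.records.lt_two_iff hS h₁.pruning u).1 hle)
    exact .imp hp fun s' hs' => .inr ⟨u, p, hs'⟩

/-- The outcome of the pruning: the stack contains the vertices in `W`, each of them above its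
parent, and the addresses of all parents are stored. -/
structure TreeInv (S : SimpleGraph (Fin n)) (root : Fin n) (W : List (Fin n)) (I : ℕ → ℕ) : Prop
    extends HasConstants I where
  pruning : IsPruning S root W
  stack : StoresStack I W
  bound : I 5 = 4 * n + 16
  pointer : I 7 = 4 * W.length + 18
  parent : ∀ p v, IsParent S root p v → I (4 * v + 17) = 4 * p + 16

theorem TreeInv.of_suffix {W W' : List (Fin n)} {I I' : ℕ → ℕ} (h : TreeInv S root W I)
    (hW' : IsPruning S root W') (hsuffix : W' <:+ W) (hI : ∀ k, k < 6 ∨ 16 ≤ k → I' k = I k)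
    (hpointer : I' 7 = 4 * W'.length + 18) : TreeInv S root W' I' where
  toHasConstants := h.toHasConstants.congr fun k hk => hI k (by omega)
  pruning := hW'
  stack v W'' hW'' := by rw [hI _ (by omega), h.stack v W'' (hW''.trans hsuffix)]
  bound := by rw [hI _ (by omega), h.bound]
  pointer := hpointer
  parent p v hp := by rw [hI _ (by omega), h.parent p v hp]

theorem PruneInv.mem {W : List (Fin n)} {c u : ℕ} {s : Mem} (h : PruneInv S root W c u s)
    (hc : n ≤ c) {v : Fin n} (hv : v ≠ root) : v ∈ W := by
  by_contra hvW
  obtain ⟨w, hw⟩ := exists_isPrunable (S := S) hv hvW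
  have := h.eq_of_isPrunable w hw (by omega)
  have := h.lt_iff
  omega

theorem PruneInv.treeInv {W : List (Fin n)} {c u : ℕ} {s : Mem} (h : PruneInv S root W c u s)
    (hc : n ≤ c) : TreeInv S root W s.I :=
  ⟨h.toHasConstants, h.pruning, h.stack, h.bound, h.pointer, fun p v hp =>
    h.records.parent p v (h.mem hc hp.ne_root) hp⟩

theorem prune_achieves {x : ℕ → ℕ} {s : Mem} (hS : S.IsTree) (h : PruneInv S root [] 0 0 s) :
    (Code.untilLE 5 6 pruneStep).Achieves x s (2 * n * 18 + 1) fun s' =>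
      ∃ W, TreeInv S root W s'.I ∧ ∀ v, v ≠ root → v ∈ W := by
  refine .mono (.imp (.untilLE (ι := List (Fin n) × ℕ × ℕ)
    (Inv := fun i => PruneInv S root i.1 i.2.1 i.2.2)
    (φ := fun i => (n - i.1.length) + (n - i.2.1)) (i := ([], 0, 0)) (fun ⟨W, c, u⟩ s h hc => ?_) h)
    fun s' ⟨⟨W, c, u⟩, h, hc⟩ => ?_) (T := (n - 0 + (n - 0)) * (1 + (13 + 2) + 2) + 1) (by omega)
  · rw [h.bound, h.scan] at hc
    have hcn : c < n := by dsimp only at hc; omega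
    refine .imp (pruneStep_achieves hS h hcn) fun s' hs' => ?_
    rcases hs' with hs' | ⟨v, p, hs'⟩
    · exact ⟨(W, c + 1, c + 1), by dsimp only; omega, hs'⟩
    · have := hs'.pruning.length_lt
      rw [Fintype.card_fin] at this
      exact ⟨(v :: W, c, p), by dsimp only [List.length_cons] at this ⊢; omega, hs'⟩
  · rw [h.bound, h.scan] at hc
    have hnc : n ≤ c := by dsimp only at hc; omega
    exact ⟨W, h.treeInv hnc, fun v => h.mem hnc⟩

end Pruning

section Placing

namespace RealRAM

/-- The preparation of the placing: the root gets the parameter 0 and the scale 1, and the scale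
factor is computed. -/
def startPlacing : List Instr :=
  [.input 8 2] ++ toAddress 8 ++ [.iadd 9 8 1, .rconst 1 1, .rconst 2 1024, .cast 3 5, .rmul 2 2 3,
    .rconst 3 0, .rstore 8 3, .rstore 9 1, .iconst 6 18]

/-- The next vertex is taken from the stack and gets its scale and its parameter. -/
def placeNext : List Instr :=
  [.isub 7 7 3, .iload 8 7, .iadd 9 8 1, .iload 10 9, .iadd 11 10 1, .rload 4 10, .rload 5 11,
    .rmul 5 5 5, .rdiv 5 5 2, .rstore 9 5, .cast 6 8, .rmul 6 6 5, .radd 4 4 6, .rstore 8 4]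

/-- The preparation of the output. -/
def startDrawing : List Instr := [.iconst 7 0, .iconst 8 16, .rconst 7 256]

/-- The output of the coordinates of the next vertex. -/
def drawNext : List Instr :=
  [.rload 4 8, .iadd 9 8 1, .rload 5 9, .rmul 5 5 5, .rdiv 5 5 7, .radd 5 1 5, .rmul 6 4 4,
    .radd 8 1 6, .rsub 9 1 6, .rdiv 9 9 8, .rmul 9 5 9, .radd 4 4 4, .rdiv 4 4 8, .rmul 4 5 4,
    .output 7 4, .iadd 7 7 1, .output 7 9, .iadd 7 7 1, .iadd 8 8 3]

end RealRAM

/-- The scale factor in the drawings that the algorithm computes for `n` vertices. -/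
noncomputable def scaleFactor (n : ℕ) : ℝ := 1024 * (4 * n + 16 : ℕ)

theorem scaleFactor_pos (n : ℕ) : 0 < scaleFactor n := by
  rw [scaleFactor]
  positivity

open RealRAM

variable {n m : ℕ} {S : SimpleGraph (Fin n)} {root : Fin n} {τ : Fin n → ℝ}

/-- The memory cells `4 * v + 16` and `4 * v + 17` hold the parameter `τ v` and the scale of the
level of `v`, except for the vertices in `W`. -/
def StoresParameters (S : SimpleGraph (Fin n)) (root : Fin n) (τ : Fin n → ℝ) (W : List (Fin n))
    (R : ℕ → ℝ) : Prop :=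
  ∀ v, v ∉ W → R (4 * v + 16) = τ v ∧ R (4 * v + 17) = levelScale (scaleFactor n) (S.dist root v)

/-- The memory during the placing: all vertices except those in `W` have been placed. -/
structure PlaceInv (S : SimpleGraph (Fin n)) (root : Fin n) (τ : Fin n → ℝ) (W : List (Fin n))
    (s : Mem) : Prop extends TreeInv S root W s.I where
  base : s.I 6 = 18
  real_one : s.R 1 = 1
  factor : s.R 2 = scaleFactor n
  parameters : StoresParameters S root τ W s.R

theorem startPlacing_achieves {ends : Fin m → Fin n × Fin n} {mark : Fin m → Bool}
    {W : List (Fin n)} {s : Mem} (h : TreeInv S root W s.I) (hW : ∀ v, v ≠ root → v ∈ W)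
    (hτ : τ root = 0) :
    (Code.block startPlacing).Achieves (encodeInstance ends mark root) s 13
      (PlaceInv S root τ W) := by
  refine .block rfl ?_
  simp (disch := omega) only [startPlacing, toAddress, List.cons_append, List.nil_append,
    List.foldlM, stepMem, exec, Mem.toConfig, Option.map_some, Option.pure_def,
    Option.bind_eq_bind, Option.bind_some, Option.some.injEq, exists_eq_left',
    Function.update_self, Function.update_of_ne, h.one, h.two, h.sixteen, h.bound, encodeInstance]
  constructor
  case parameters =>
    intro v hv
    obtain rfl : v = root := by_contra fun hne => hv (hW v hne)
    rw [show 4 * (v : ℕ) + 16 = v + v + (v + v) + 16 by ring,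
      show 4 * (v : ℕ) + 17 = v + v + (v + v) + 16 + 1 by ring]
    simp (disch := omega) only [Function.update_self, Function.update_of_ne]
    rw [hτ, SimpleGraph.dist_self, Int.cast_zero, Int.cast_one]
    exact ⟨rfl, rfl⟩
  case toTreeInv =>
    refine h.of_suffix h.pruning List.suffix_rfl (fun k hk => ?_) ?_ <;>
      simp (disch := omega) only [Function.update_of_ne, h.pointer]
  all_goals simp (disch := omega) only [Function.update_self, Function.update_of_ne]
  exacts [Int.cast_one, by rw [scaleFactor]; norm_num]

theorem placeNext_achieves {x : ℕ → ℕ} {W : List (Fin n)} {u : Fin n} {s : Mem} (hS : S.IsTree)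
    (h : PlaceInv S root τ (u :: W) s)
    (hτ : ∀ p v, IsParent S root p v →
      τ v = τ p + (4 * v + 16 : ℕ) * levelScale (scaleFactor n) (S.dist root v)) :
    (Code.block placeNext).Achieves x s 14 (PlaceInv S root τ W) := by
  obtain - | ⟨hW, hu⟩ := h.pruning
  obtain ⟨p, hp⟩ := exists_isParent hS.connected hu.ne_root
  have hu_addr := h.stack u W List.suffix_rfl
  have hp_addr := h.parent p u hp
  have hp_par := h.parameters p (hu.parent_notMem hW hp)
  have hq := (scaleFactor_pos n).ne'
  have hscale : levelScale (scaleFactor n) (S.dist root u) =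
      levelScale (scaleFactor n) (S.dist root p) * levelScale (scaleFactor n) (S.dist root p) /
        scaleFactor n := by rw [hp.2, levelScale, sq]
  have hlen : 4 * (u :: W).length + 18 - 4 = 4 * W.length + 18 := by rw [List.length_cons]; omega
  refine .block rfl ?_
  simp (disch := omega) only [placeNext, List.foldlM,
    stepMem, exec, Mem.toConfig, Option.map_some, Option.pure_def,
    Option.bind_eq_bind, Option.bind_some, Option.some.injEq, exists_eq_left',
    Function.update_self, Function.update_of_ne, h.one, h.four, h.pointer, h.factor, hlen, hu_addr,
    hp_addr, hp_par.1, hp_par.2, hq, ↓reduceIte]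
  rw [← hscale, ← hτ p u hp]
  constructor
  case parameters =>
    intro v hv
    obtain rfl | hvu := eq_or_ne v u
    · simp (disch := omega) only [Function.update_self, Function.update_of_ne, and_self]
    · have hvu' := Fin.val_ne_of_ne hvu
      simp (disch := omega) only [Function.update_of_ne]
      exact h.parameters v (List.not_mem_cons_of_ne_of_not_mem hvu hv)
  case toTreeInv =>
    refine h.of_suffix hW (List.suffix_cons u W) (fun k hk => ?_) ?_ <;>
      simp (disch := omega) only [Function.update_self, Function.update_of_ne]
  all_goals simp (disch := omega) only [Function.update_of_ne]
  exacts [h.base, h.real_one, h.factor]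

/-- The memory while the drawing is written: the coordinates of the vertices before `j` are in the
output. -/
structure DrawInv (S : SimpleGraph (Fin n)) (root : Fin n) (τ : Fin n → ℝ) (j : ℕ) (s : Mem) :
    Prop extends HasConstants s.I where
  bound : s.I 5 = 4 * n + 16
  pointer : s.I 7 = 2 * j
  current : s.I 8 = 4 * j + 16
  real_one : s.R 1 = 1
  denominator : s.R 7 = 256
  parameters : StoresParameters S root τ [] s.R
  out_eq : ∀ v : Fin n, v < j → decodeDrawing n s.out v = placement S root (scaleFactor n) τ v

theorem startDrawing_achieves {x : ℕ → ℕ} {s : Mem} (h : PlaceInv S root τ [] s) :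
    (Code.block startDrawing).Achieves x s 3 (DrawInv S root τ 0) := by
  refine .block rfl ?_
  simp only [startDrawing, List.foldlM,
    stepMem, exec, Mem.toConfig, Option.map_some, Option.pure_def,
    Option.bind_eq_bind, Option.bind_some, Option.some.injEq, exists_eq_left']
  constructor
  case toHasConstants =>
    exact h.toHasConstants.congr fun k hk => by simp (disch := omega) only [Function.update_of_ne]
  case parameters =>
    intro v hv
    simp (disch := omega) only [Function.update_of_ne]
    exact h.parameters v hv
  case out_eq => exact fun v hv => absurd hv v.1.not_lt_zero
  all_goals simp (disch := omega) only [Function.update_self, Function.update_of_ne]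
  exacts [h.bound, h.real_one, by norm_num]

theorem drawNext_achieves {x : ℕ → ℕ} {j : Fin n} {s : Mem} (h : DrawInv S root τ j s) :
    (Code.block drawNext).Achieves x s 19 (DrawInv S root τ (j + 1)) := by
  obtain ⟨hpar, hscale⟩ := h.parameters j List.not_mem_nil
  have hden : 1 + τ j * τ j ≠ 0 := (add_pos_of_pos_of_nonneg one_pos (mul_self_nonneg _)).ne'
  have h256 : (256 : ℝ) ≠ 0 := by norm_num
  refine .block rfl ?_
  simp (disch := omega) only [drawNext, List.foldlM,
    stepMem, exec, Mem.toConfig, Option.map_some, Option.pure_def,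
    Option.bind_eq_bind, Option.bind_some, Option.some.injEq, exists_eq_left',
    Function.update_self, Function.update_of_ne, h.one, h.four, h.pointer, h.current, h.real_one,
    h.denominator, hpar, hscale, hden, h256, ↓reduceIte]
  constructor
  case toHasConstants =>
    exact h.toHasConstants.congr fun k hk => by simp (disch := omega) only [Function.update_of_ne]
  case parameters =>
    intro v hv
    simp (disch := omega) only [Function.update_of_ne]
    exact h.parameters v hv
  case out_eq =>
    intro v hv
    obtain rfl | hne := eq_or_ne v j
    · simp (disch := omega) only [decodeDrawing, Function.update_self, Function.update_of_ne,
        placement, circlePoint, levelRadius, sq, two_mul]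
    · have hne' := Fin.val_ne_of_ne hne
      rw [← h.out_eq v (by omega), decodeDrawing, decodeDrawing]
      simp (disch := omega) only [Function.update_of_ne]
  all_goals simp (disch := omega) only [Function.update_self, Function.update_of_ne]
  exacts [h.bound, by ring, by ring, h.real_one, h.denominator]

theorem place_achieves {x : ℕ → ℕ} {W : List (Fin n)} {s : Mem} (hS : S.IsTree)
    (h : PlaceInv S root τ W s)
    (hτ : ∀ p v, IsParent S root p v →
      τ v = τ p + (4 * v + 16 : ℕ) * levelScale (scaleFactor n) (S.dist root v)) :
    (Code.untilLE 7 6 (.block placeNext)).Achieves x s (n * 16 + 1) (PlaceInv S root τ []) := by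
  have hlen := h.pruning.length_lt
  rw [Fintype.card_fin] at hlen
  refine .mono (.imp (.untilLE (Inv := PlaceInv S root τ) (φ := List.length)
    (fun W s h hlt => ?_) h) fun s' ⟨W, h, hle⟩ => ?_) (T := W.length * 16 + 1) (by omega)
  · rw [h.pointer, h.base] at hlt
    obtain ⟨u, W, rfl⟩ := List.exists_cons_of_length_pos (show 0 < W.length by omega)
    exact .imp (placeNext_achieves hS h hτ) fun s' hs' => ⟨W, by simp, hs'⟩
  · rw [h.pointer, h.base] at hle
    obtain rfl := List.length_eq_zero_iff.1 (show W.length = 0 by omega)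
    exact h

theorem draw_achieves {x : ℕ → ℕ} {s : Mem} (h : DrawInv S root τ 0 s) :
    (Code.untilLE 5 8 (.block drawNext)).Achieves x s (n * 21 + 1) fun s' =>
      decodeDrawing n s'.out = placement S root (scaleFactor n) τ := by
  refine .imp (.untilLE (Inv := DrawInv S root τ) (φ := fun j => n - j)
    (fun j s h hlt => ?_) h) fun s' ⟨j, h, hle⟩ => ?_
  · rw [h.bound, h.current] at hlt
    exact .imp (drawNext_achieves (j := ⟨j, by omega⟩) h) fun s' hs' => ⟨j + 1, by omega, hs'⟩
  · rw [h.bound, h.current] at hle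
    exact funext fun v => h.out_eq v (by omega)

end Placing

section DrawingProgram

namespace RealRAM

/-- The drawing algorithm: the edges of the tree are read, its vertices other than the root are
removed leaf by leaf, and in the opposite order they are placed. -/
def drawCode : Code :=
  .seq (.block prepare) <| .seq (.untilLE 5 6 readEdge) <|
  .seq (.block startPruning) <| .seq (.untilLE 5 6 pruneStep) <|
  .seq (.block startPlacing) <| .seq (.untilLE 7 6 (.block placeNext)) <|
  .seq (.block startDrawing) (.untilLE 5 8 (.block drawNext))

/-- The program that computes the drawings. -/
def drawProgram : Program := drawCode.compile 0 ++ [.halt]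

end RealRAM

open RealRAM

variable {n m : ℕ} {G S : SimpleGraph (Fin n)} {root : Fin n} {ends : Fin m → Fin n × Fin n}
  {mark : Fin m → Bool} {τ : Fin n → ℝ}

theorem drawCode_achieves (hT : IsBFSTree G S root) (hE : IsEdgeList G S ends mark)
    (hroot : τ root = 0)
    (hτ : ∀ p v, IsParent S root p v →
      τ v = τ p + (4 * v + 16 : ℕ) * levelScale (scaleFactor n) (S.dist root v)) :
    drawCode.Achieves (encodeInstance ends mark root) ⟨fun _ => 0, fun _ => 0, fun _ => 0⟩
      (6 + (m * 31 + 1 + (14 + (2 * n * 18 + 1 + (13 + (n * 16 + 1 + (3 + (n * 21 + 1))))))))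
      fun s => decodeDrawing n s.out = placement S root (scaleFactor n) τ := by
  refine .seq (prepare_achieves root) fun s₁ h₁ => .seq (readEdges_achieves hE h₁) fun s₂ h₂ => ?_
  rw [hE.markedNeighbors_eq hT.le] at h₂
  exact .seq (startPruning_achieves h₂) fun s₃ h₃ => .seq (prune_achieves hT.isTree h₃)
    fun s₄ ⟨W, h₄, hW⟩ => .seq (startPlacing_achieves h₄ hW hroot) fun s₅ h₅ =>
    .seq (place_achieves hT.isTree h₅ hτ) fun s₆ h₆ => .seq (startDrawing_achieves h₆)
    fun s₇ h₇ => draw_achieves h₇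

theorem isParameterization_scaleFactor (hroot : τ root = 0)
    (hτ : ∀ p v, IsParent S root p v →
      τ v = τ p + (4 * v + 16 : ℕ) * levelScale (scaleFactor n) (S.dist root v)) :
    IsParameterization S root (4 * n + 12 : ℕ) (scaleFactor n) (fun v => (4 * v + 16 : ℕ)) τ where
  one_le v := by exact_mod_cast (by omega : 1 ≤ 4 * (v : ℕ) + 16)
  le v := by exact_mod_cast (by omega : 4 * (v : ℕ) + 16 ≤ 4 * n + 12)
  sep v w hne := one_le_abs_natCast_sub fun h => hne (Fin.ext (by omega))
  le_q := by
    rw [scaleFactor]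
    push_cast
    linarith
  root_eq := hroot
  child_eq := hτ

theorem drawProgram_haltsWith (hT : IsBFSTree G S root) (hE : IsEdgeList G S ends mark) :
    ∃ t ≤ 114 * (n + m), ∃ y τ, HaltsWith drawProgram (encodeInstance ends mark root) t y ∧
      IsParameterization S root (4 * n + 12 : ℕ) (scaleFactor n) (fun v => (4 * v + 16 : ℕ)) τ ∧
      decodeDrawing n y = placement S root (scaleFactor n) τ := by
  obtain ⟨τ, hroot, hτ⟩ := exists_potential hT.isTree root
    fun v => ((4 * v + 16 : ℕ) : ℝ) * levelScale (scaleFactor n) (S.dist root v)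
  obtain ⟨t, ht, s, hs, hd⟩ := (drawCode_achieves hT hE hroot hτ).exists_haltsWith
  have hn := root.pos
  exact ⟨t, by omega, s.out, τ, hs, isParameterization_scaleFactor hroot hτ, hd⟩

end DrawingProgram

section Area

/-- Twice the signed area of the triangle `abc`, which bounds from below the area of the drawings
that contain it. -/
def triangleDet (a b c : Plane) : ℝ :=
  (b 0 - a 0) * (c 1 - a 1) - (c 0 - a 0) * (b 1 - a 1)

/-- The rotation by `-θ` about the origin followed by the scaling by `s`: an enclosing rectangle in
the definition of `drawingArea` is an axis-parallel rectangle for the images of the vertices. -/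
noncomputable def rotateScale (s θ : ℝ) (a : Plane) : Plane :=
  !₂[s * (Real.cos θ * a 0 + Real.sin θ * a 1), s * (-Real.sin θ * a 0 + Real.cos θ * a 1)]

theorem triangleDet_rotateScale (s θ : ℝ) (a b c : Plane) :
    triangleDet (rotateScale s θ a) (rotateScale s θ b) (rotateScale s θ c) =
      s ^ 2 * triangleDet a b c := by
  simp only [triangleDet, rotateScale, Matrix.cons_val_zero, Matrix.cons_val_one]
  linear_combination s ^ 2 * ((b 0 - a 0) * (c 1 - a 1) - (c 0 - a 0) * (b 1 - a 1)) *
    Real.sin_sq_add_cos_sq θ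

theorem abs_triangleDet_le {a b c : Plane} {x₁ x₂ y₁ y₂ : ℝ}
    (ha : a 0 ∈ Set.Icc x₁ x₂ ∧ a 1 ∈ Set.Icc y₁ y₂)
    (hb : b 0 ∈ Set.Icc x₁ x₂ ∧ b 1 ∈ Set.Icc y₁ y₂)
    (hc : c 0 ∈ Set.Icc x₁ x₂ ∧ c 1 ∈ Set.Icc y₁ y₂) :
    |triangleDet a b c| ≤ 2 * ((x₂ - x₁) * (y₂ - y₁)) := by
  have hx : 0 ≤ x₂ - x₁ := sub_nonneg.2 (ha.1.1.trans ha.1.2)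
  calc |triangleDet a b c|
      ≤ |b 0 - a 0| * |c 1 - a 1| + |c 0 - a 0| * |b 1 - a 1| := by
        rw [← abs_mul, ← abs_mul]
        exact abs_sub _ _
    _ ≤ (x₂ - x₁) * (y₂ - y₁) + (x₂ - x₁) * (y₂ - y₁) := by
        gcongr <;> apply abs_sub_le_of_le_of_le
        exacts [hb.1.1, hb.1.2, ha.1.1, ha.1.2, hc.2.1, hc.2.2, ha.2.1, ha.2.2,
          hc.1.1, hc.1.2, ha.1.1, ha.1.2, hb.2.1, hb.2.2, ha.2.1, ha.2.2]
    _ = 2 * ((x₂ - x₁) * (y₂ - y₁)) := (two_mul _).symm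

variable {V : Type u}

theorem exists_scaling [Finite V] {Γ : V → Plane} (hΓ : Function.Injective Γ) :
    ∃ s : ℝ, 0 < s ∧ ∀ v w, v ≠ w → 1 ≤ s * dist (Γ v) (Γ w) := by
  obtain ⟨M, hM⟩ := (Set.finite_range fun p : V × V => (dist (Γ p.1) (Γ p.2))⁻¹).bddAbove
  refine ⟨max M 1, by positivity, fun v w hvw => ?_⟩
  have hdist : 0 < dist (Γ v) (Γ w) := dist_pos.2 (hΓ.ne hvw)
  rw [← inv_le_iff_one_le_mul₀ hdist]
  exact (hM ⟨(v, w), rfl⟩).trans (le_max_left M 1)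

theorem exists_mem_Icc_of_finite [Finite V] (f : V → ℝ) : ∃ x y : ℝ, ∀ v, f v ∈ Set.Icc x y := by
  obtain ⟨x, hx⟩ := (Set.finite_range f).bddBelow
  obtain ⟨y, hy⟩ := (Set.finite_range f).bddAbove
  exact ⟨x, y, fun v => ⟨hx ⟨v, rfl⟩, hy ⟨v, rfl⟩⟩⟩

/-- The scaling in the definition of the area makes the distance of `v` and `w` at least `1`. -/
theorem abs_triangleDet_div_le_drawingArea [Finite V] {Γ : V → Plane} (hΓ : Function.Injective Γ)
    (a b c : V) {v w : V} (hvw : v ≠ w) :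
    |triangleDet (Γ a) (Γ b) (Γ c)| / (2 * dist (Γ v) (Γ w) ^ 2) ≤ drawingArea Γ := by
  refine le_csInf ?_ ?_
  · obtain ⟨s, hs, hd⟩ := exists_scaling hΓ
    obtain ⟨x₁, x₂, hx⟩ := exists_mem_Icc_of_finite fun v => rotateScale s 0 (Γ v) 0
    obtain ⟨y₁, y₂, hy⟩ := exists_mem_Icc_of_finite fun v => rotateScale s 0 (Γ v) 1
    exact ⟨_, s, 0, x₁, x₂, y₁, y₂, hs, hd, fun v => ⟨hx v, hy v⟩, rfl⟩
  · rintro A ⟨s, θ, x₁, x₂, y₁, y₂, -, hd, hbox, rfl⟩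
    have hbox' v : rotateScale s θ (Γ v) 0 ∈ Set.Icc x₁ x₂ ∧
        rotateScale s θ (Γ v) 1 ∈ Set.Icc y₁ y₂ := hbox v
    have hdet := abs_triangleDet_le (hbox' a) (hbox' b) (hbox' c)
    rw [triangleDet_rotateScale, abs_mul, abs_sq] at hdet
    have hscaled : 1 ≤ s ^ 2 * dist (Γ v) (Γ w) ^ 2 := by
      rw [← mul_pow]
      exact one_le_pow₀ (hd v w hvw)
    have hdist : 0 < dist (Γ v) (Γ w) := dist_pos.2 (hΓ.ne hvw)
    rw [div_le_iff₀ (by positivity)]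
    calc |triangleDet (Γ a) (Γ b) (Γ c)|
        ≤ s ^ 2 * dist (Γ v) (Γ w) ^ 2 * |triangleDet (Γ a) (Γ b) (Γ c)| :=
          le_mul_of_one_le_left (abs_nonneg _) hscaled
      _ = s ^ 2 * |triangleDet (Γ a) (Γ b) (Γ c)| * dist (Γ v) (Γ w) ^ 2 := by ring
      _ ≤ 2 * ((x₂ - x₁) * (y₂ - y₁)) * dist (Γ v) (Γ w) ^ 2 := by gcongr
      _ = (x₂ - x₁) * (y₂ - y₁) * (2 * dist (Γ v) (Γ w) ^ 2) := by ring

theorem triangleDet_circlePoint (r a b c : ℝ) :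
    triangleDet (circlePoint r a) (circlePoint r b) (circlePoint r c) =
      r ^ 2 * (4 * ((b - a) * (b - c) * (c - a))) /
        ((1 + a ^ 2) * (1 + b ^ 2) * (1 + c ^ 2)) := by
  have ha : 1 + a ^ 2 ≠ 0 := by positivity
  have hb : 1 + b ^ 2 ≠ 0 := by positivity
  have hc : 1 + c ^ 2 ≠ 0 := by positivity
  simp only [triangleDet, circlePoint, Matrix.cons_val_zero, Matrix.cons_val_one]
  field_simp
  ring

theorem le_abs_triangleDet_circlePoint {r a b c : ℝ} (hr : 1 ≤ r) (ha : |a| ≤ 1) (hb : |b| ≤ 1)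
    (hc : |c| ≤ 1) :
    |b - a| * |b - c| * |c - a| / 2 ≤
      |triangleDet (circlePoint r a) (circlePoint r b) (circlePoint r c)| := by
  have hden {x : ℝ} (hx : |x| ≤ 1) : 1 + x ^ 2 ≤ 2 := by
    linarith [(sq_le_one_iff_abs_le_one x).2 hx]
  have hprod : (1 + a ^ 2) * (1 + b ^ 2) * (1 + c ^ 2) ≤ 2 * 2 * 2 := by
    gcongr <;> exact hden ‹_›
  rw [triangleDet_circlePoint, abs_div, abs_of_pos (by positivity :
    0 < (1 + a ^ 2) * (1 + b ^ 2) * (1 + c ^ 2)), le_div_iff₀ (by positivity), abs_mul, abs_sq,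
    abs_mul, abs_mul, abs_mul, abs_of_pos (four_pos : (0 : ℝ) < 4)]
  calc |b - a| * |b - c| * |c - a| / 2 * ((1 + a ^ 2) * (1 + b ^ 2) * (1 + c ^ 2))
      ≤ |b - a| * |b - c| * |c - a| / 2 * (2 * 2 * 2) := by gcongr
    _ = 1 * (4 * (|b - a| * |b - c| * |c - a|)) := by ring
    _ ≤ r ^ 2 * (4 * (|b - a| * |b - c| * |c - a|)) := by
      gcongr
      exact one_le_pow₀ hr

theorem levelScale_mul_pow_le_one {q : ℝ} (hq : 1 ≤ q) (l : ℕ) : levelScale q l * q ^ l ≤ 1 := by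
  induction l with
  | zero => simp only [levelScale, pow_zero, mul_one, le_refl]
  | succ l ih =>
    calc levelScale q (l + 1) * q ^ (l + 1) = q * levelScale q (l + 1) * q ^ l := by ring
      _ ≤ levelScale q l * q ^ l := by
        gcongr
        exact mul_levelScale_succ_le hq l
      _ ≤ 1 := ih

namespace IsParameterization

variable {S : SimpleGraph V} {root : V} {N q : ℝ} {f t : V → ℝ}

theorem inv_pow_le_abs_triangleDet (h : IsParameterization S root N q f t) (hS : S.Connected)
    {a b c : V} (hab : a ≠ b) (hbc : b ≠ c) (hca : c ≠ a) (ha : S.dist root a = 1)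
    (hb : S.dist root b = 1) (hc : S.dist root c = 1) :
    (q ^ 3)⁻¹ / 2 ≤ |triangleDet (placement S root q t a) (placement S root q t b)
      (placement S root q t c)| := by
  have hsep {v w : V} (hvw : v ≠ w) (hv : S.dist root v = 1) (hw : S.dist root w = 1) :
      q⁻¹ ≤ |t v - t w| := by
    simpa only [hv, levelScale_one, one_div] using h.levelScale_le_abs_sub hS hvw (hv.trans hw.symm)
  have hq : 0 < q⁻¹ := inv_pos.2 (by linarith [h.le_scaleFactor])
  rw [placement, placement, placement, ha, hb, hc]
  refine le_trans ?_ (le_abs_triangleDet_circlePoint (h.one_lt_levelRadius 1).le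
    (h.abs_le_one hS a) (h.abs_le_one hS b) (h.abs_le_one hS c))
  calc (q ^ 3)⁻¹ / 2 = q⁻¹ * q⁻¹ * q⁻¹ / 2 := by rw [← inv_pow]; ring
    _ ≤ |t b - t a| * |t b - t c| * |t c - t a| / 2 := by
      gcongr
      exacts [hsep hab.symm hb ha, hsep hbc hb hc, hsep hca hc ha]

theorem dist_edge_mul_pow_le_one (h : IsParameterization S root N q f t) {p v : V}
    (hv : IsParent S root p v) :
    dist (placement S root q t v) (placement S root q t p) * q ^ (2 * S.dist root p) ≤ 1 := by
  have hq := h.le_scaleFactor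
  have hpos := h.levelScale_pos (S.dist root p)
  calc dist (placement S root q t v) (placement S root q t p) * q ^ (2 * S.dist root p)
      ≤ levelScale q (S.dist root p) ^ 2 / 128 * q ^ (2 * S.dist root p) := by
        rw [dist_eq_norm]
        gcongr
        exact h.norm_placement_edge_le hv
    _ = (levelScale q (S.dist root p) * q ^ S.dist root p) ^ 2 / 128 := by ring
    _ ≤ 1 ^ 2 / 128 := by
        gcongr
        exact levelScale_mul_pow_le_one (by linarith) _
    _ ≤ 1 := by norm_num

/-- The triangle on the first level has size polynomial in `1 / q`, while the edge from `p` to `v`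
is exponentially short in the level of `p`. -/
theorem pow_le_drawingArea [Finite V] (h : IsParameterization S root N q f t) (hS : S.Connected)
    {a b c : V} (hab : a ≠ b) (hbc : b ≠ c) (hca : c ≠ a) (ha : S.dist root a = 1)
    (hb : S.dist root b = 1) (hc : S.dist root c = 1) {p v : V} (hv : IsParent S root p v) :
    q ^ (4 * S.dist root p) ≤ 4 * q ^ 3 * drawingArea (placement S root q t) := by
  have hinj := (h.isFinePlacement hS).injective
  have hq : 0 < q := by linarith [h.le_scaleFactor]
  have harea := abs_triangleDet_div_le_drawingArea hinj a b c hv.1.ne'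
  have htriangle := h.inv_pow_le_abs_triangleDet hS hab hbc hca ha hb hc
  have hedge := h.dist_edge_mul_pow_le_one hv
  set d := dist (placement S root q t v) (placement S root q t p)
  have hd : 0 < d := dist_pos.2 (hinj.ne hv.1.ne')
  calc q ^ (4 * S.dist root p)
      = (d * q ^ (2 * S.dist root p)) ^ 2 / d ^ 2 := by
        field_simp
        ring
    _ ≤ 1 ^ 2 / d ^ 2 := by gcongr
    _ = 4 * q ^ 3 * ((q ^ 3)⁻¹ / 2 / (2 * d ^ 2)) := by
        field_simp
        norm_num
    _ ≤ 4 * q ^ 3 * drawingArea (placement S root q t) := by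
        gcongr
        exact le_trans (by gcongr) harea

end IsParameterization

end Area

section Broom

variable {n : ℕ}

theorem isEdgeList_parentGraph {parent : Fin (n + 1) → Fin (n + 1)} {level : Fin (n + 1) → ℕ}
    (hparent : ∀ v, v ≠ 0 → parent v < v)
    (hlevel : ∀ v, v ≠ 0 → level (parent v) + 1 = level v) :
    IsEdgeList (parentGraph 0 parent) (parentGraph 0 parent)
      (fun j : Fin n => (j.succ, parent j.succ)) (fun _ => true) where
  injective i j hij := by
    rcases Sym2.eq_iff.1 hij with ⟨h, -⟩ | ⟨hi, hj⟩
    · exact Fin.succ_injective _ h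
    · have hi_lt := hparent i.succ (Fin.succ_ne_zero i)
      have hj_lt := hparent j.succ (Fin.succ_ne_zero j)
      dsimp only at hi hj
      rw [hj] at hi_lt
      exact absurd (hi ▸ hj_lt) hi_lt.asymm
  range_eq := by
    ext e
    induction e with | _ a b
    rw [SimpleGraph.mem_edgeSet, parentGraph_adj hlevel]
    constructor
    · rintro ⟨j, hj⟩
      rcases Sym2.eq_iff.1 hj with ⟨rfl, rfl⟩ | ⟨rfl, rfl⟩
      exacts [.inl ⟨Fin.succ_ne_zero j, rfl⟩, .inr ⟨Fin.succ_ne_zero j, rfl⟩]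
    · rintro (⟨h, rfl⟩ | ⟨h, rfl⟩) <;> obtain ⟨j, rfl⟩ := Fin.exists_succ_eq.2 h
      exacts [⟨j, rfl⟩, ⟨j, Sym2.eq_swap⟩]
  mark_iff j := iff_of_true rfl ((parentGraph_adj hlevel).2 (.inl ⟨Fin.succ_ne_zero j, rfl⟩))

/-- The parent function of a tree in which three paths start at the root `0`, two of them with a
single edge and the third one through all other vertices. -/
def broomParent (v : Fin (n + 1)) : Fin (n + 1) :=
  ⟨if (v : ℕ) ≤ 3 then 0 else v - 1, by split_ifs <;> omega⟩

/-- The level of a vertex in the tree with the parent function `broomParent`. -/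
def broomLevel (v : Fin (n + 1)) : ℕ :=
  if (v : ℕ) = 0 then 0 else if (v : ℕ) ≤ 3 then 1 else v - 2

theorem broomParent_lt (v : Fin (n + 1)) (hv : v ≠ 0) : broomParent v < v := by
  have := Fin.val_ne_zero_iff.2 hv
  rw [Fin.lt_def, broomParent]
  dsimp only
  split_ifs <;> omega

theorem broomLevel_parent (v : Fin (n + 1)) (hv : v ≠ 0) :
    broomLevel (broomParent v) + 1 = broomLevel v := by
  have := Fin.val_ne_zero_iff.2 hv
  simp only [broomLevel, broomParent]
  split_ifs <;> omega

theorem dist_broom (v : Fin (n + 1)) : (parentGraph 0 broomParent).dist 0 v = broomLevel v :=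
  parentGraph_dist broomLevel_parent (if_pos rfl) v

theorem isParent_broom (hn : 4 ≤ n) :
    IsParent (parentGraph 0 broomParent) 0 (⟨n - 1, by omega⟩ : Fin (n + 1)) ⟨n, by omega⟩ := by
  refine ⟨(parentGraph_adj broomLevel_parent).2 (.inr ⟨?_, ?_⟩), ?_⟩
  · exact Fin.val_ne_zero_iff.1 (show n ≠ 0 by omega)
  · exact Fin.ext (if_neg (show ¬ n ≤ 3 by omega)).symm
  · rw [dist_broom, dist_broom, broomLevel, broomLevel]
    dsimp only
    split_ifs <;> omega

theorem two_pow_le_drawingArea_broom {N q : ℝ} {f t : Fin (n + 1) → ℝ} (hn : 6 ≤ n)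
    (h : IsParameterization (parentGraph 0 broomParent) 0 N q f t) :
    2 ^ (n + 1) ≤ drawingArea (placement (parentGraph 0 broomParent) 0 q t) := by
  have hq := h.le_scaleFactor
  have harea := h.pow_le_drawingArea (parentGraph_connected broomLevel_parent)
    (a := ⟨1, by omega⟩) (b := ⟨2, by omega⟩) (c := ⟨3, by omega⟩) (by simp) (by simp) (by simp)
    (by rw [dist_broom]; rfl) (by rw [dist_broom]; rfl) (by rw [dist_broom]; rfl)
    (isParent_broom (by omega))
  rw [dist_broom, broomLevel, if_neg (show ¬ n - 1 = 0 by omega),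
    if_neg (show ¬ n - 1 ≤ 3 by omega)] at harea
  refine le_of_mul_le_mul_left ?_ (show 0 < 4 * q ^ 3 by positivity)
  calc 4 * q ^ 3 * 2 ^ (n + 1)
      = 2 ^ (n + 3) * q ^ 3 := by ring
    _ ≤ q ^ (n + 3) * q ^ 3 := by gcongr; linarith
    _ = q ^ (n + 6) := by ring
    _ ≤ q ^ (4 * (n - 1 - 2)) := pow_le_pow_right₀ (by linarith) (by omega)
    _ ≤ _ := harea

end Broom

theorem theorem3 :
    -- every BFS-tree has a compatible drawing, with the levels on nested concentric circles
    (∀ (V : Type u) [Finite V] (G S : SimpleGraph V) (root : V), IsBFSTree G S root →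
      ∃ Γ : V → Plane, IsCompatibleDrawing G S Γ ∧ LevelsOnNestedCircles S root Γ) ∧
    -- such drawings are computed by one program in linear time on a real RAM
    (∃ P : RealRAM.Program,
      (∃ C : ℕ, ∀ (n m : ℕ) (G S : SimpleGraph (Fin n)) (root : Fin n)
        (ends : Fin m → Fin n × Fin n) (mark : Fin m → Bool),
        IsBFSTree G S root → IsEdgeList G S ends mark →
        ∃ (t : ℕ) (y : ℕ → ℝ), t ≤ C * (n + m) ∧
          RealRAM.HaltsWith P (encodeInstance ends mark root) t y ∧
          IsCompatibleDrawing G S (decodeDrawing n y) ∧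
          LevelsOnNestedCircles S root (decodeDrawing n y)) ∧
      -- whose drawings may have exponential area
      (∃ c : ℝ, 0 < c ∧ ∃ n₀ : ℕ, ∀ n ≥ n₀,
        ∃ (m : ℕ) (G S : SimpleGraph (Fin n)) (root : Fin n)
          (ends : Fin m → Fin n × Fin n) (mark : Fin m → Bool),
          IsBFSTree G S root ∧ IsEdgeList G S ends mark ∧
          ∃ (t : ℕ) (y : ℕ → ℝ), RealRAM.HaltsWith P (encodeInstance ends mark root) t y ∧
            c * 2 ^ n ≤ drawingArea (decodeDrawing n y))) ∧
    -- every connected graph has, for every choice of the root, a spanning tree that is a BFS-tree,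
    -- and hence a straight-line drawing in which this tree is not crossed
    (∀ (V : Type u) [Finite V] (G : SimpleGraph V), G.Connected → ∀ root : V,
      ∃ S : SimpleGraph V, IsBFSTree G S root ∧
        ∃ Γ : V → Plane, IsCompatibleDrawing G S Γ) := by
  refine ⟨fun V _ G S root h => exists_compatible_drawing h,
    ⟨RealRAM.drawProgram, ⟨114, ?_⟩, 1, one_pos, 7, fun n hn => ?_⟩, fun V _ G hG root => ?_⟩
  · intro n m G S root ends mark hT hE
    obtain ⟨t, ht, y, τ, hy, hτ, hd⟩ := drawProgram_haltsWith hT hE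
    have hfine := hτ.isFinePlacement hT.isTree.connected
    exact ⟨t, y, ht, hy, hd ▸ hfine.isCompatibleDrawing hT, hd ▸ hfine.levelsOnNestedCircles⟩
  · obtain ⟨n, rfl⟩ := Nat.exists_eq_add_of_le' (show 1 ≤ n by omega)
    have hT := isBFSTree_self (parentGraph_isTree (broomLevel_parent (n := n))) 0
    have hE := isEdgeList_parentGraph (broomParent_lt (n := n)) broomLevel_parent
    obtain ⟨t, -, y, τ, hy, hτ, hd⟩ := drawProgram_haltsWith hT hE
    refine ⟨n, _, _, 0, _, _, hT, hE, t, y, hy, ?_⟩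
    rw [one_mul, hd]
    exact two_pow_le_drawingArea_broom (by omega) hτ
  · obtain ⟨S, hS⟩ := exists_isBFSTree hG root
    obtain ⟨Γ, hΓ, -⟩ := exists_compatible_drawing hS
    exact ⟨S, hS, Γ, hΓ⟩
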